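/- Let $n\ge 3$; $B_r(x)\subset\mathbb R^n$ is the open ball, $B_r=B_r(0)$, and $|\cdot|$ is Lebesgue measure. For measurable $E\subset\mathbb R^n$ let $P(E)=\sup\{\int_E \operatorname{div}T : T\in C^1_c(\mathbb R^n;\mathbb R^n),\ |T|\le 1\}$ be its perimeter and, for $\beta\ge 1$, let $a_E=\mathbf 1_{E^c}+\beta\mathbf 1_E$. Let $D^1(\mathbb R^n)$ be the completion of $C_c^\infty(\mathbb R^n)$ with respect to $\|\nabla\varphi\|_{L^2}$ (a space of functions in $L^{2n/(n-2)}$, by the Sobolev inequality), and let $\mathcal A(E)$ be the set of pairs $(u,\rho)\in D^1(\mathbb R^n)\times L^2(\mathbb R^n)$ such that $\rho=0$ a.e. outside $E$, $\int\rho=1$ and $-\operatorname{div}(a_E\nabla u)=\rho$ in the sense of distributions on $\mathbb R^n$. For $K>0$, $Q\ge 0$ put $$\mathcal G_{\beta,K}(E)=\inf_{(u,\rho)\in\mathcal A(E)}\Big\{\int_{\mathbb R^n}a_E|\nabla u|^2+K\int_E\rho^2\Big\},\qquad \mathcal F_{\beta,K,Q}(E)=P(E)+Q^2\,\mathcal G_{\beta,K}(E),$$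 with values in $[0,\infty]$, where $\inf\emptyset=\infty$ and $0\cdot\infty=0$. **Proposition ($\Lambda$-minimality).** For every $n\ge 3$ and $A>0$ there are constants $\Lambda_1>0$ and $\bar r_1>0$, depending only on $n$ and $A$, with the following property. Let $\beta\ge 1$, $K>0$, $Q\ge 0$ satisfy $\beta+K+\frac1K+Q\le A$, let $R\ge 1$, and let $E$ be a minimizer of $$\min\{\mathcal F_{\beta,K,Q}(E) : E\subset B_R \text{ measurable},\ |E|=|B_1|\}.$$ Then $$\mathcal F_{\beta,K,Q}(E)\le \mathcal F_{\beta,K,Q}(F)+\Lambda_1\,|E\Delta F|$$ for every measurable $F\subset B_R$ such that $E\Delta F\subset B_r(x_0)$ for some $x_0\in\mathbb R^n$ and some $r\le\bar r_1$. In particular the constants do not depend on $R$, and $F$ is not subject to any volume constraint. -/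

import Mathlib

open MeasureTheory Filter Topology
open scoped ENNReal

noncomputable section

namespace ChargedDroplet

/-- Euclidean space `ℝⁿ`. -/
abbrev Space (n : ℕ) : Type := EuclideanSpace ℝ (Fin n)

/-- The divergence `∑ᵢ ∂ᵢ Tᵢ` of a (differentiable) vector field. -/
def divergence {n : ℕ} (T : Space n → Space n) (x : Space n) : ℝ :=
  ∑ i : Fin n, (fderiv ℝ T x (EuclideanSpace.single i 1)) i

/-- The De Giorgi perimeter `P(E)`: the supremum of `∫_E div T` over all `C¹` compactly supported
vector fields `T` with `|T| ≤ 1`. It is `⊤` when `E` does not have finite perimeter. -/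
def perimeter {n : ℕ} (E : Set (Space n)) : ℝ≥0∞ :=
  ⨆ (T : Space n → Space n) (_ : ContDiff ℝ 1 T ∧ HasCompactSupport T ∧ ∀ x, ‖T x‖ ≤ 1),
    ENNReal.ofReal (∫ x in E, divergence T x)

/-- Real-valued test functions, the space `C_c^∞(ℝⁿ)`. -/
def IsTestFunction {n : ℕ} (φ : Space n → ℝ) : Prop :=
  ContDiff ℝ (⊤ : ℕ∞) φ ∧ HasCompactSupport φ

/-- The Sobolev exponent `2* = 2n / (n - 2)`, for `n ≥ 3`. -/
def sobolevExponent (n : ℕ) : ℝ≥0∞ := ENNReal.ofReal (2 * (n : ℝ) / ((n : ℝ) - 2))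

/-- `u` belongs to `D¹(ℝⁿ)`, the completion of `C_c^∞(ℝⁿ)` for the norm `‖∇φ‖_{L²}`, and its
gradient is `g`. By the Sobolev inequality a sequence of test functions that is Cauchy for this norm
converges in `L^{2*}`; its class in the completion is the function `u` to which it converges there,
and `g = ∇u` is the `L²` limit of the gradients. -/
structure HasD1Gradient {n : ℕ} (u : Space n → ℝ) (g : Space n → Space n) : Prop where
  memLp : MemLp u (sobolevExponent n) volume
  memLp_grad : MemLp g 2 volume
  exists_approx : ∃ φ : ℕ → Space n → ℝ, (∀ k, IsTestFunction (φ k)) ∧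
    Tendsto (fun k => eLpNorm (φ k - u) (sobolevExponent n) volume) atTop (𝓝 0) ∧
    Tendsto (fun k => eLpNorm (gradient (φ k) - g) 2 volume) atTop (𝓝 0)

/-- The permittivity `a_E = 1_{Eᶜ} + β 1_E`. -/
def permittivity {n : ℕ} (β : ℝ) (E : Set (Space n)) (x : Space n) : ℝ :=
  Eᶜ.indicator (fun _ => (1 : ℝ)) x + E.indicator (fun _ => β) x

/-- `(u, ρ)` is an admissible pair for `E`, where `g` is the gradient of `u`: `u ∈ D¹(ℝⁿ)`,
`ρ ∈ L²(ℝⁿ)`, `ρ = 0` outside `E`, `∫ ρ = 1`, and `-div (a_E ∇u) = ρ` in the sense of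
distributions. -/
structure IsAdmissible {n : ℕ} (β : ℝ) (E : Set (Space n))
    (u : Space n → ℝ) (g : Space n → Space n) (ρ : Space n → ℝ) : Prop where
  hasD1Gradient : HasD1Gradient u g
  memLp : MemLp ρ 2 volume
  eq_zero_off : ∀ᵐ x, x ∉ E → ρ x = 0
  integrable : Integrable ρ volume
  integral_eq_one : ∫ x, ρ x = 1
  weak_eq : ∀ ψ : Space n → ℝ, IsTestFunction ψ →
    ∫ x, permittivity β E x * inner ℝ (g x) (gradient ψ x) = ∫ x, ρ x * ψ x

/-- The energy `∫ a_E |∇u|² + K ∫_E ρ²` of a pair, where `g = ∇u`. -/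
def pairEnergy {n : ℕ} (β K : ℝ) (E : Set (Space n))
    (g : Space n → Space n) (ρ : Space n → ℝ) : ℝ≥0∞ :=
  (∫⁻ x, ENNReal.ofReal (permittivity β E x * ‖g x‖ ^ 2)) +
    ENNReal.ofReal K * ∫⁻ x in E, ENNReal.ofReal (ρ x ^ 2)

/-- `𝒢_{β,K}(E)`: the infimum of the energy over all admissible pairs (`⊤` if there is none). -/
def chargeEnergy {n : ℕ} (β K : ℝ) (E : Set (Space n)) : ℝ≥0∞ :=
  ⨅ (u : Space n → ℝ) (g : Space n → Space n) (ρ : Space n → ℝ) (_ : IsAdmissible β E u g ρ),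
    pairEnergy β K E g ρ

/-- The total energy `ℱ_{β,K,Q}(E) = P(E) + Q² 𝒢_{β,K}(E)`. -/
def energy {n : ℕ} (β K Q : ℝ) (E : Set (Space n)) : ℝ≥0∞ :=
  perimeter E + ENNReal.ofReal (Q ^ 2) * chargeEnergy β K E

/-- The competitors for the droplet problem: the (Lebesgue) measurable sets `E ⊂ B_R`
with `|E| = |B_1|`. -/
structure IsCompetitor {n : ℕ} (R : ℝ) (E : Set (Space n)) : Prop where
  measurable : NullMeasurableSet E volume
  subset_ball : E ⊆ Metric.ball 0 R
  volume_eq : volume E = volume (Metric.ball (0 : Space n) 1)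

/-- `E` solves `min {ℱ_{β,K,Q}(E) : |E| = |B_1|, E ⊂ B_R}`. -/
structure IsMinimizer {n : ℕ} (β K Q R : ℝ) (E : Set (Space n)) : Prop where
  isCompetitor : IsCompetitor R E
  energy_le : ∀ G : Set (Space n), IsCompetitor R G → energy β K Q E ≤ energy β K Q G

/-- The parameters `β ≥ 1`, `K > 0`, `Q ≥ 0` are controlled by `A`. -/
structure ControlledBy (A β K Q : ℝ) : Prop where
  one_le_beta : 1 ≤ β
  K_pos : 0 < K
  Q_nonneg : 0 ≤ Q
  sum_le : β + K + 1 / K + Q ≤ A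

end ChargedDroplet

end

/-!
The energy is compared along three elementary moves, none of which needs a compactness argument or a
regularity theory for sets of finite perimeter; all bounds are quantitative, so that no constant
depends on `R`.

*Charge.* By the Riesz representation theorem in `L²(a_E dx)`, a charge density `ρ` with
`|∫ ρ ψ| ≤ C (∫ a_E |∇ψ|²)^{1/2}` has a potential of Dirichlet energy at most `C²`
(`chargeEnergy_le_of_bound`). Hence `𝒢` decreases when the set grows (`chargeEnergy_anti`), it is
multiplied by at most `c⁻ⁿ` when the set is shrunk by `c ≤ 1` (`chargeEnergy_smul_le`), and it is
bounded on the unit ball (`exists_chargeEnergy_ball_le`).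

*Volume too large.* If `|F| ≥ |B₁|`, then `F` shrunk to the volume `|B₁|` is a competitor, so
`ℱ(E) ≤ ℱ(F) + ((|F| - |B₁|) / |B₁|) Q² 𝒢(F)` (`IsMinimizer.energy_le_of_volume_ge`). One may assume
`ℱ(F) ≤ ℱ(E) ≤ ℱ(B₁)`, which bounds the last factor.

*Volume too small.* Shrinking cannot be reversed inside `B_R`. Instead, the union with a ball of
radius `s` increases the perimeter by at most `(n / s) |B_s(y) ∖ F|` (`perimeter_union_ball_le`, a
calibration) and does not increase `𝒢`. If `F` contains almost all of a ball of radius `s`, this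
ball can be grown continuously to `B_R`, and on the way it adds exactly the missing volume
(`exists_ball_diff_eq`), at a cost linear in `|B₁| - |F|`.

It remains to find a ball of a definite radius that `E`, and hence `F`, fills up
(`exists_filled_ball`). The translation estimate `|E ∖ (E - h)| ≤ |h| P(E)`
(`measureReal_diff_translate_le`), averaged over `h`, produces a point of `E` about which `E` is
dense at a small scale, and yields the isoperimetric inequality. The case of large volume, applied
to `E ∪ B_t(y)`, shows `P(E) ≤ P(E ∪ B_t(y)) + C |B_t(y) ∖ E|`; with this, De Giorgi's iteration
(`exists_density_const`) shows that a ball in which `E` is dense enough is filled by `E` up to half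
its radius.
-/

namespace ChargedDroplet

variable {n : ℕ}

/-! ### Test functions and their gradients -/

lemma norm_gradient (φ : Space n → ℝ) (x : Space n) : ‖gradient φ x‖ = ‖fderiv ℝ φ x‖ := by
  simp [gradient]

namespace IsTestFunction

variable {φ ψ : Space n → ℝ}

lemma contDiff_one (h : IsTestFunction φ) : ContDiff ℝ 1 φ :=
  h.1.of_le (by exact_mod_cast le_top)

lemma differentiable (h : IsTestFunction φ) : Differentiable ℝ φ :=
  h.contDiff_one.differentiable (by simp)

lemma continuous_gradient (h : IsTestFunction φ) : Continuous (gradient φ) := by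
  unfold gradient
  exact (LinearIsometryEquiv.continuous _).comp (h.contDiff_one.continuous_fderiv (by simp))

lemma hasCompactSupport_gradient (h : IsTestFunction φ) : HasCompactSupport (gradient φ) := by
  unfold gradient
  exact (h.2.fderiv (𝕜 := ℝ)).comp_left (g := (InnerProductSpace.toDual ℝ (Space n)).symm)
    (map_zero _)

lemma memLp_gradient (h : IsTestFunction φ) (p : ℝ≥0∞) : MemLp (gradient φ) p volume :=
  h.continuous_gradient.memLp_of_hasCompactSupport h.hasCompactSupport_gradient

lemma memLp (h : IsTestFunction φ) (p : ℝ≥0∞) : MemLp φ p volume :=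
  h.1.continuous.memLp_of_hasCompactSupport h.2

lemma add (h : IsTestFunction φ) (h' : IsTestFunction ψ) : IsTestFunction (φ + ψ) :=
  ⟨h.1.add h'.1, h.2.add h'.2⟩

lemma const_smul (c : ℝ) (h : IsTestFunction φ) : IsTestFunction (c • φ) :=
  ⟨contDiff_const.smul h.1, h.2.smul_left (f := fun _ => c)⟩

lemma sub (h : IsTestFunction φ) (h' : IsTestFunction ψ) : IsTestFunction (φ - ψ) :=
  ⟨h.1.sub h'.1, by simpa [sub_eq_add_neg] using h.2.add h'.2.neg⟩

end IsTestFunction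

/-- The space of test functions as a linear subspace of all functions. -/
def testFunctions (n : ℕ) : Submodule ℝ (Space n → ℝ) where
  carrier := {φ | IsTestFunction φ}
  add_mem' := IsTestFunction.add
  zero_mem' := ⟨contDiff_const, HasCompactSupport.zero⟩
  smul_mem' c _ h := h.const_smul c

lemma gradient_add_of_test {φ ψ : Space n → ℝ} (h : IsTestFunction φ) (h' : IsTestFunction ψ) :
    gradient (φ + ψ) = gradient φ + gradient ψ := by
  ext1 x
  simp [gradient, fderiv_add (h.differentiable x) (h'.differentiable x)]

lemma gradient_const_smul_of_test {φ : Space n → ℝ} (c : ℝ) (h : IsTestFunction φ) :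
    gradient (c • φ) = c • gradient φ := by
  ext1 x
  simp [gradient, fderiv_const_smul (h.differentiable x)]

lemma gradient_sub_of_test {φ ψ : Space n → ℝ} (h : IsTestFunction φ) (h' : IsTestFunction ψ) :
    gradient (φ - ψ) = gradient φ - gradient ψ := by
  ext1 x
  simp [gradient, fderiv_sub (h.differentiable x) (h'.differentiable x)]

lemma sobolevExponent_eq_coe (n : ℕ) :
    sobolevExponent n = ((2 * (n : ℝ) / ((n : ℝ) - 2)).toNNReal : ℝ≥0∞) := rfl

lemma one_le_sobolevExponent (hn : 3 ≤ n) : 1 ≤ sobolevExponent n := by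
  have : (3 : ℝ) ≤ n := by exact_mod_cast hn
  rw [sobolevExponent, ENNReal.one_le_ofReal, le_div_iff₀ (by linarith)]
  linarith

/-- The Sobolev inequality for test functions, `‖φ‖_{2*} ≤ C ‖∇φ‖₂`. -/
lemma exists_sobolev_const (hn : 3 ≤ n) : ∃ C : NNReal, ∀ φ : Space n → ℝ, IsTestFunction φ →
    eLpNorm φ (sobolevExponent n) volume ≤ C * eLpNorm (gradient φ) 2 volume := by
  refine ⟨SNormLESNormFDerivOfEqConst ℝ (volume : Measure (Space n)) 2, fun φ h => ?_⟩
  have h3 : (3 : ℝ) ≤ n := by exact_mod_cast hn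
  have key := eLpNorm_le_eLpNorm_fderiv_of_eq (volume : Measure (Space n)) h.contDiff_one h.2
    (p := 2) (p' := (2 * (n : ℝ) / ((n : ℝ) - 2)).toNNReal) (by norm_num)
    (by simp; omega)
    (by
      rw [Real.coe_toNNReal _ (div_nonneg (by linarith) (by linarith))]
      have h2 : (n : ℝ) - 2 ≠ 0 := by linarith
      have h0 : (n : ℝ) ≠ 0 := by linarith
      rw [finrank_euclideanSpace, Fintype.card_fin, NNReal.coe_inv, NNReal.coe_ofNat]
      field_simp)
  rw [sobolevExponent_eq_coe,
    eLpNorm_congr_norm_ae (Eventually.of_forall fun x => norm_gradient φ x)]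
  exact_mod_cast key

/-! ### The permittivity and the weighted Lebesgue measure -/

lemma permittivity_of_mem {β : ℝ} {E : Set (Space n)} {x : Space n} (hx : x ∈ E) :
    permittivity β E x = β := by simp [permittivity, hx]

lemma permittivity_of_notMem {β : ℝ} {E : Set (Space n)} {x : Space n} (hx : x ∉ E) :
    permittivity β E x = 1 := by simp [permittivity, hx]

lemma one_le_permittivity {β : ℝ} (hβ : 1 ≤ β) (E : Set (Space n)) (x : Space n) :
    1 ≤ permittivity β E x := by
  by_cases hx : x ∈ E
  · rwa [permittivity_of_mem hx]
  · rw [permittivity_of_notMem hx]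

lemma permittivity_le {β : ℝ} (hβ : 1 ≤ β) (E : Set (Space n)) (x : Space n) :
    permittivity β E x ≤ β := by
  by_cases hx : x ∈ E
  · rw [permittivity_of_mem hx]
  · rwa [permittivity_of_notMem hx]

lemma permittivity_mono {β : ℝ} (hβ : 1 ≤ β) {E F : Set (Space n)} (h : E ⊆ F) (x : Space n) :
    permittivity β E x ≤ permittivity β F x := by
  by_cases hx : x ∈ E
  · rw [permittivity_of_mem hx, permittivity_of_mem (h hx)]
  · rw [permittivity_of_notMem hx]
    exact one_le_permittivity hβ F x

lemma aemeasurable_permittivity (β : ℝ) {E : Set (Space n)} (hE : NullMeasurableSet E volume) :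
    AEMeasurable (permittivity β E) volume :=
  (aemeasurable_const.indicator₀ hE.compl).add (aemeasurable_const.indicator₀ hE)

/-- The measure `a_E dx`. Its `L²` norm of `∇u` is the square root of `∫ a_E |∇u|²`. -/
noncomputable def permittivityMeasure (β : ℝ) (E : Set (Space n)) : Measure (Space n) :=
  volume.withDensity fun x => ENNReal.ofReal (permittivity β E x)

section permittivityMeasure

variable {β : ℝ} {E : Set (Space n)}

lemma volume_le_permittivityMeasure (hβ : 1 ≤ β) :
    volume ≤ permittivityMeasure β E := by
  conv_lhs => rw [← withDensity_one (μ := (volume : Measure (Space n)))]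
  refine withDensity_mono (Eventually.of_forall fun x => ?_)
  simpa using one_le_permittivity hβ E x

lemma permittivityMeasure_le (hβ : 1 ≤ β) :
    permittivityMeasure β E ≤ ENNReal.ofReal β • volume := by
  rw [← withDensity_const]
  exact withDensity_mono (Eventually.of_forall fun x =>
    ENNReal.ofReal_le_ofReal (permittivity_le hβ E x))

lemma integral_permittivityMeasure (hβ : 1 ≤ β) (hE : NullMeasurableSet E volume)
    (f : Space n → ℝ) :
    ∫ x, f x ∂(permittivityMeasure β E) = ∫ x, permittivity β E x * f x := by
  rw [permittivityMeasure, integral_withDensity_eq_integral_toReal_smul₀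
    (aemeasurable_permittivity β hE).ennreal_ofReal (by simp)]
  refine integral_congr_ae (Eventually.of_forall fun x => ?_)
  simp [ENNReal.toReal_ofReal (zero_le_one.trans (one_le_permittivity hβ E x))]

lemma memLp_permittivityMeasure_iff (hβ : 1 ≤ β) {V : Type*} [NormedAddCommGroup V]
    {f : Space n → V} {p : ℝ≥0∞} :
    MemLp f p (permittivityMeasure β E) ↔ MemLp f p volume :=
  ⟨fun h => h.mono_measure (volume_le_permittivityMeasure hβ),
    fun h => h.of_measure_le_smul ENNReal.ofReal_ne_top (permittivityMeasure_le hβ)⟩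

end permittivityMeasure

/-! ### The charge energy from a dual bound on the charge -/

/-- The Riesz representation theorem for a functional on a space mapped into a Hilbert space,
bounded by the norm of the image; the representing vector lies in the closure of the range. -/
lemma exists_riesz_of_bound {W H : Type*} [AddCommGroup W] [Module ℝ W]
    [NormedAddCommGroup H] [InnerProductSpace ℝ H] [CompleteSpace H]
    (D : W →ₗ[ℝ] H) (ℓ : W →ₗ[ℝ] ℝ) {C : ℝ} (hC : 0 ≤ C) (hb : ∀ w, |ℓ w| ≤ C * ‖D w‖) :
    ∃ σ : H, σ ∈ closure (Set.range D) ∧ (∀ w, inner ℝ σ (D w) = ℓ w) ∧ ‖σ‖ ≤ C := by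
  let V : Submodule ℝ H := (LinearMap.range D).topologicalClosure
  have hmem : ∀ w, D w ∈ V := fun w =>
    (LinearMap.range D).le_topologicalClosure (LinearMap.mem_range_self D w)
  have : CompleteSpace V := (LinearMap.range D).isClosed_topologicalClosure.completeSpace_coe
  let D' : W →ₗ[ℝ] V := D.codRestrict V hmem
  have hdense : DenseRange D' := by
    intro v
    rw [closure_subtype]
    have hv : (v : H) ∈ closure (Set.range D) := by
      have := v.2
      rwa [← SetLike.mem_coe, Submodule.topologicalClosure_coe, LinearMap.coe_range] at this
    refine closure_mono ?_ hv
    rintro _ ⟨w, rfl⟩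
    exact ⟨D' w, ⟨w, rfl⟩, rfl⟩
  have hb' : ∀ w, ‖ℓ w‖ ≤ C * ‖D' w‖ := fun w => by simpa [D'] using hb w
  let L : V →L[ℝ] ℝ := ℓ.extendOfNorm D'
  let σ : V := (InnerProductSpace.toDual ℝ V).symm L
  refine ⟨σ, ?_, fun w => ?_, ?_⟩
  · have := σ.2
    rwa [← SetLike.mem_coe, Submodule.topologicalClosure_coe, LinearMap.coe_range] at this
  · have h1 : inner ℝ σ (D' w) = L (D' w) := InnerProductSpace.toDual_symm_apply
    rw [LinearMap.extendOfNorm_eq hdense ⟨C, hb'⟩ w] at h1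
    simpa [D'] using h1
  · have : ‖σ‖ = ‖L‖ := by simp [σ]
    rw [← Submodule.coe_norm, this]
    exact L.opNorm_le_bound hC (LinearMap.norm_extendOfNorm_apply_le hdense C hb')

/-- Completeness of `D¹`: an `L²` limit of gradients of test functions is the gradient of an element
of `D¹`. -/
lemma exists_hasD1Gradient (hn : 3 ≤ n) {g : Space n → Space n} (hg : MemLp g 2 volume)
    {φ : ℕ → Space n → ℝ} (hφ : ∀ k, IsTestFunction (φ k))
    (hlim : Tendsto (fun k => eLpNorm (gradient (φ k) - g) 2 volume) atTop (𝓝 0)) :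
    ∃ u, HasD1Gradient u g := by
  obtain ⟨C, hC⟩ := exists_sobolev_const hn
  have : Fact (1 ≤ sobolevExponent n) := ⟨one_le_sobolevExponent hn⟩
  let f : ℕ → Lp ℝ (sobolevExponent n) (volume : Measure (Space n)) :=
    fun k => ((hφ k).memLp (sobolevExponent n)).toLp (φ k)
  have hcau : CauchySeq f := by
    have hG : CauchySeq fun k => ((hφ k).memLp_gradient 2).toLp (gradient (φ k)) :=
      ((Lp.tendsto_Lp_iff_tendsto_eLpNorm'' (fun k => gradient (φ k))
        (fun k => (hφ k).memLp_gradient 2) g hg).2 hlim).cauchySeq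
    rw [EMetric.cauchySeq_iff] at hG ⊢
    intro ε hε
    obtain ⟨N, hN⟩ := hG (ε / (C + 1)) (ENNReal.div_pos hε.ne' (by simp))
    refine ⟨N, fun k hk l hl => ?_⟩
    have h1 := hN k hk l hl
    rw [Lp.edist_toLp_toLp] at h1 ⊢
    rw [← gradient_sub_of_test (hφ k) (hφ l)] at h1
    calc _ ≤ C * eLpNorm (gradient (φ k - φ l)) 2 volume := hC _ ((hφ k).sub (hφ l))
      _ ≤ (C + 1) * eLpNorm (gradient (φ k - φ l)) 2 volume := by gcongr; simp
      _ < ε := by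
        rw [mul_comm]
        exact ENNReal.mul_lt_of_lt_div h1
  obtain ⟨u, hu⟩ := cauchySeq_tendsto_of_complete hcau
  refine ⟨u, Lp.memLp u, hg, φ, hφ, ?_, hlim⟩
  exact (Lp.tendsto_Lp_iff_tendsto_eLpNorm'' (fun k => φ k)
    (fun k => (hφ k).memLp (sobolevExponent n)) u (Lp.memLp u)).1 (by rwa [Lp.toLp_coeFn])

/-- If the charge `ρ` satisfies `|∫ ρ ψ| ≤ C (∫ a_E |∇ψ|²)^{1/2}` for all test functions `ψ`, its
potential exists and has Dirichlet energy at most `C²`. -/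
theorem chargeEnergy_le_of_bound (hn : 3 ≤ n) {β K C : ℝ} (hβ : 1 ≤ β) {E : Set (Space n)}
    (hE : NullMeasurableSet E volume) {ρ : Space n → ℝ} (hρ2 : MemLp ρ 2 volume)
    (hρ0 : ∀ᵐ x, x ∉ E → ρ x = 0) (hρi : Integrable ρ volume) (hρ1 : ∫ x, ρ x = 1)
    (hC : 0 ≤ C)
    (hb : ∀ ψ, IsTestFunction ψ →
      |∫ x, ρ x * ψ x| ≤ C * √(∫ x, permittivity β E x * ‖gradient ψ x‖ ^ 2)) :
    chargeEnergy β K E ≤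
      ENNReal.ofReal (C ^ 2) + ENNReal.ofReal K * ∫⁻ x in E, ENNReal.ofReal (ρ x ^ 2) := by
  set μ := permittivityMeasure β E with hμ
  have hmem : ∀ ψ, IsTestFunction ψ → MemLp (gradient ψ) 2 μ := fun ψ h =>
    (memLp_permittivityMeasure_iff hβ).2 (h.memLp_gradient 2)
  have hint : ∀ ψ, IsTestFunction ψ → Integrable (fun x => ρ x * ψ x) volume := fun ψ h =>
    MemLp.integrable_mul hρ2 (h.memLp 2)
  let D : testFunctions n →ₗ[ℝ] Lp (Space n) 2 μ :=
    { toFun := fun ψ => (hmem ψ.1 ψ.2).toLp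
      map_add' := fun ψ χ => by
        rw [← MemLp.toLp_add]
        exact MemLp.toLp_congr _ _ (by
          rw [Submodule.coe_add, gradient_add_of_test ψ.2 χ.2])
      map_smul' := fun c ψ => by
        rw [RingHom.id_apply, ← MemLp.toLp_const_smul]
        exact MemLp.toLp_congr _ _ (by
          rw [Submodule.coe_smul, gradient_const_smul_of_test c ψ.2]) }
  let ℓ : testFunctions n →ₗ[ℝ] ℝ :=
    { toFun := fun ψ => ∫ x, ρ x * ψ.1 x
      map_add' := fun ψ χ => by
        rw [← integral_add (hint _ ψ.2) (hint _ χ.2)]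
        simp [mul_add]
      map_smul' := fun c ψ => by
        rw [RingHom.id_apply, smul_eq_mul, ← integral_const_mul]
        simp [mul_left_comm] }
  have hDn : ∀ f : Lp (Space n) 2 μ,
      ‖f‖ ^ 2 = ∫ x, permittivity β E x * ‖f x‖ ^ 2 := fun f => by
    rw [← real_inner_self_eq_norm_sq, L2.inner_def, ← integral_permittivityMeasure hβ hE]
    simp only [real_inner_self_eq_norm_sq, hμ]
  have hvac : (volume : Measure (Space n)) ≪ μ :=
    Measure.absolutelyContinuous_of_le (volume_le_permittivityMeasure hβ)
  have hcoe : ∀ ψ : testFunctions n, D ψ =ᵐ[volume] gradient ψ.1 := fun ψ =>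
    hvac.ae_le (MemLp.coeFn_toLp (hmem ψ.1 ψ.2))
  have hbound : ∀ ψ, |ℓ ψ| ≤ C * ‖D ψ‖ := fun ψ => by
    have h2 : ‖D ψ‖ = √(∫ x, permittivity β E x * ‖gradient ψ.1 x‖ ^ 2) := by
      rw [← Real.sqrt_sq (norm_nonneg (D ψ)), hDn]
      congr 1
      refine integral_congr_ae ?_
      filter_upwards [hcoe ψ] with x hx
      rw [hx]
    rw [h2]
    exact hb ψ.1 ψ.2
  obtain ⟨σ, hσc, hσ, hσn⟩ := exists_riesz_of_bound D ℓ hC hbound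
  obtain ⟨s, hs, hslim⟩ := mem_closure_iff_seq_limit.1 hσc
  choose φ hφ using hs
  have hσ2 : MemLp σ 2 volume := (memLp_permittivityMeasure_iff hβ).1 (Lp.memLp σ)
  have hlim : Tendsto (fun k => eLpNorm (gradient (φ k).1 - (σ : Space n → Space n)) 2 volume)
      atTop (𝓝 0) := by
    have h1 := (Lp.tendsto_Lp_iff_tendsto_eLpNorm'' (fun k => gradient (φ k).1)
      (fun k => hmem _ (φ k).2) σ (Lp.memLp σ)).1
      (by
        rw [Lp.toLp_coeFn]
        exact hslim.congr fun k => (hφ k).symm)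
    exact tendsto_of_tendsto_of_tendsto_of_le_of_le tendsto_const_nhds h1 (fun _ => zero_le)
      fun k => eLpNorm_mono_measure _ (volume_le_permittivityMeasure hβ)
  obtain ⟨u, hu⟩ := exists_hasD1Gradient hn hσ2 (fun k => (φ k).2) hlim
  have hadm : IsAdmissible β E u σ ρ := by
    refine ⟨hu, hρ2, hρ0, hρi, hρ1, fun ψ hψ => ?_⟩
    have h1 := hσ ⟨ψ, hψ⟩
    rw [L2.inner_def, integral_permittivityMeasure hβ hE] at h1
    rw [show ∫ x, ρ x * ψ x = ℓ ⟨ψ, hψ⟩ from rfl, ← h1]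
    refine integral_congr_ae ?_
    filter_upwards [hcoe ⟨ψ, hψ⟩] with x hx
    rw [hx]
  refine (show chargeEnergy β K E ≤ pairEnergy β K E σ ρ from
    iInf_le_of_le u <| iInf_le_of_le (⇑σ) <| iInf_le_of_le ρ <| iInf_le _ hadm).trans ?_
  unfold pairEnergy
  gcongr
  have hi : Integrable (fun x => permittivity β E x * ‖σ x‖ ^ 2) volume := by
    refine (hσ2.integrable_norm_pow (by norm_num)).bdd_mul (c := β)
      (aemeasurable_permittivity β hE).aestronglyMeasurable (Eventually.of_forall fun x => ?_)
    rw [Real.norm_of_nonneg (zero_le_one.trans (one_le_permittivity hβ E x))]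
    exact permittivity_le hβ E x
  rw [← ofReal_integral_eq_lintegral_ofReal hi (Eventually.of_forall fun x =>
    mul_nonneg (zero_le_one.trans (one_le_permittivity hβ E x)) (by positivity)), ← hDn]
  gcongr

/-! ### Monotonicity, scaling and finiteness of the charge energy -/

section

variable {β : ℝ} {E : Set (Space n)}

lemma integrable_permittivity_mul (hβ : 1 ≤ β) (hE : NullMeasurableSet E volume)
    {f : Space n → ℝ} (hf : Integrable f volume) :
    Integrable (fun x => permittivity β E x * f x) volume := by
  refine hf.bdd_mul (c := β)
    (aemeasurable_permittivity β hE).aestronglyMeasurable (Eventually.of_forall fun x => ?_)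
  rw [Real.norm_of_nonneg (zero_le_one.trans (one_le_permittivity hβ E x))]
  exact permittivity_le hβ E x

lemma permittivity_mul_sq_nonneg (hβ : 1 ≤ β) (E : Set (Space n)) (x : Space n) (t : ℝ) :
    0 ≤ permittivity β E x * t ^ 2 :=
  mul_nonneg (zero_le_one.trans (one_le_permittivity hβ E x)) (by positivity)

/-- The Cauchy–Schwarz inequality for the form `∫ a_E ⟨f, g⟩`. -/
lemma abs_integral_permittivity_inner_le (hβ : 1 ≤ β) (hE : NullMeasurableSet E volume)
    {f g : Space n → Space n} (hf : MemLp f 2 volume) (hg : MemLp g 2 volume) :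
    |∫ x, permittivity β E x * inner ℝ (f x) (g x)| ≤
      √(∫ x, permittivity β E x * ‖f x‖ ^ 2) * √(∫ x, permittivity β E x * ‖g x‖ ^ 2) := by
  have hf' := (memLp_permittivityMeasure_iff (E := E) hβ).2 hf
  have hg' := (memLp_permittivityMeasure_iff (E := E) hβ).2 hg
  have key : ∀ {f g : Space n → Space n} (hf : MemLp f 2 (permittivityMeasure β E))
      (hg : MemLp g 2 (permittivityMeasure β E)), inner ℝ (hf.toLp f) (hg.toLp g) =
        ∫ x, permittivity β E x * inner ℝ (f x) (g x) := by
    intro f g hf hg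
    rw [L2.inner_def, ← integral_permittivityMeasure hβ hE]
    refine integral_congr_ae ?_
    filter_upwards [hf.coeFn_toLp, hg.coeFn_toLp] with x h1 h2
    rw [h1, h2]
  have hnorm : ∀ {f : Space n → Space n} (hf : MemLp f 2 (permittivityMeasure β E)),
      ‖hf.toLp f‖ = √(∫ x, permittivity β E x * ‖f x‖ ^ 2) := by
    intro f hf
    rw [← Real.sqrt_sq (norm_nonneg (hf.toLp f)), ← real_inner_self_eq_norm_sq, key hf hf]
    simp only [real_inner_self_eq_norm_sq]
  rw [← key hf' hg', ← hnorm hf', ← hnorm hg']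
  exact abs_real_inner_le_norm _ _

lemma IsAdmissible.pairEnergy_eq {K : ℝ} (hβ : 1 ≤ β) (hE : NullMeasurableSet E volume)
    {u ρ : Space n → ℝ} {g : Space n → Space n} (h : IsAdmissible β E u g ρ) :
    pairEnergy β K E g ρ = ENNReal.ofReal (∫ x, permittivity β E x * ‖g x‖ ^ 2) +
      ENNReal.ofReal K * ENNReal.ofReal (∫ x, ρ x ^ 2) := by
  rw [pairEnergy, ofReal_integral_eq_lintegral_ofReal
    (integrable_permittivity_mul hβ hE (h.hasD1Gradient.memLp_grad.integrable_norm_pow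
      (by norm_num))) (Eventually.of_forall fun x => permittivity_mul_sq_nonneg hβ E x _),
    ofReal_integral_eq_lintegral_ofReal h.memLp.integrable_sq
      (Eventually.of_forall fun x => sq_nonneg _), ← lintegral_indicator₀ hE]
  congr 2
  refine lintegral_congr_ae ?_
  filter_upwards [h.eq_zero_off] with x hx
  by_cases hxE : x ∈ E <;> simp [hxE]
  simp [hx hxE]

lemma chargeEnergy_le_of_bound_integral (hn : 3 ≤ n) {K C : ℝ} (hβ : 1 ≤ β)
    (hE : NullMeasurableSet E volume) {ρ : Space n → ℝ} (hρ2 : MemLp ρ 2 volume)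
    (hρ0 : ∀ᵐ x, x ∉ E → ρ x = 0) (hρi : Integrable ρ volume) (hρ1 : ∫ x, ρ x = 1)
    (hC : 0 ≤ C)
    (hb : ∀ ψ, IsTestFunction ψ →
      |∫ x, ρ x * ψ x| ≤ C * √(∫ x, permittivity β E x * ‖gradient ψ x‖ ^ 2)) :
    chargeEnergy β K E ≤
      ENNReal.ofReal (C ^ 2) + ENNReal.ofReal K * ENNReal.ofReal (∫ x, ρ x ^ 2) := by
  refine (chargeEnergy_le_of_bound hn (K := K) hβ hE hρ2 hρ0 hρi hρ1 hC hb).trans ?_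
  rw [ofReal_integral_eq_lintegral_ofReal hρ2.integrable_sq
    (Eventually.of_forall fun x => sq_nonneg _)]
  gcongr
  exact Measure.restrict_le_self

/-- A larger droplet has a larger permittivity and more room for the charge, hence a smaller charge
energy. -/
theorem chargeEnergy_anti (hn : 3 ≤ n) {K : ℝ} (hβ : 1 ≤ β) {F : Set (Space n)}
    (hE : NullMeasurableSet E volume) (hF : NullMeasurableSet F volume) (hEF : E ⊆ F) :
    chargeEnergy β K F ≤ chargeEnergy β K E := by
  refine le_iInf fun u => le_iInf fun g => le_iInf fun ρ => le_iInf fun h => ?_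
  rw [h.pairEnergy_eq hβ hE]
  have hnn : 0 ≤ ∫ x, permittivity β E x * ‖g x‖ ^ 2 :=
    integral_nonneg fun x => permittivity_mul_sq_nonneg hβ E x _
  rw [← Real.sq_sqrt hnn]
  refine chargeEnergy_le_of_bound_integral hn hβ hF h.memLp ?_ h.integrable h.integral_eq_one
    (Real.sqrt_nonneg _) fun ψ hψ => ?_
  · filter_upwards [h.eq_zero_off] with x hx hxF using hx fun hxE => hxF (hEF hxE)
  · rw [← h.weak_eq ψ hψ]
    refine (abs_integral_permittivity_inner_le hβ hE h.hasD1Gradient.memLp_grad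
      (hψ.memLp_gradient 2)).trans ?_
    have hi := (hψ.memLp_gradient 2).integrable_norm_pow (by norm_num)
    gcongr ?_ * √?_
    refine integral_mono (integrable_permittivity_mul hβ hE hi)
      (integrable_permittivity_mul hβ hF hi) fun x => ?_
    exact mul_le_mul_of_nonneg_right (permittivity_mono hβ hEF x) (by positivity)

open scoped Pointwise

lemma IsTestFunction.comp_smul {ψ : Space n → ℝ} (hψ : IsTestFunction ψ) {c : ℝ} (hc : c ≠ 0) :
    IsTestFunction fun x => ψ (c • x) :=
  ⟨hψ.1.comp (contDiff_const_smul c), hψ.2.comp_homeomorph (Homeomorph.smulOfNeZero c hc)⟩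

lemma gradient_comp_smul (ψ : Space n → ℝ) (c : ℝ) (x : Space n) :
    gradient (fun x => ψ (c • x)) x = c • gradient ψ (c • x) := by
  simp [gradient, fderiv_comp_smul]

lemma nullMeasurableSet_smul (hE : NullMeasurableSet E volume) {c : ℝ} (hc : c ≠ 0) :
    NullMeasurableSet (c • E) volume := by
  rw [← Set.preimage_smul_inv₀ hc]
  exact hE.preimage (Measure.quasiMeasurePreserving_smul volume (inv_ne_zero hc))

/-- Shrinking a droplet by the factor `c ≤ 1` multiplies its charge energy by at most `c⁻ⁿ`, as one
sees from the rescaled charge density `c⁻ⁿ ρ(x / c)`. -/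
theorem chargeEnergy_smul_le (hn : 3 ≤ n) {K : ℝ} (hβ : 1 ≤ β)
    (hE : NullMeasurableSet E volume) {c : ℝ} (hc : 0 < c) (hc1 : c ≤ 1) :
    chargeEnergy β K (c • E) ≤ ENNReal.ofReal ((c ^ n)⁻¹) * chargeEnergy β K E := by
  have hcE := nullMeasurableSet_smul hE hc.ne'
  have hcn : 0 < c ^ n := by positivity
  have hfin : Module.finrank ℝ (Space n) = n := by simp
  have hscale : ∀ f : Space n → ℝ, ∫ x, f (c • x) = (c ^ n)⁻¹ * ∫ x, f x := fun f => by
    rw [Measure.integral_comp_smul, hfin, abs_of_pos (by positivity), smul_eq_mul]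
  have hscale' : ∀ f : Space n → ℝ, ∫ x, f (c⁻¹ • x) = c ^ n * ∫ x, f x := fun f => by
    rw [Measure.integral_comp_inv_smul, hfin, abs_of_pos hcn, smul_eq_mul]
  unfold chargeEnergy
  simp_rw [ENNReal.mul_iInf_of_ne (ENNReal.ofReal_pos.2 (inv_pos.2 hcn)).ne'
    ENNReal.ofReal_ne_top]
  refine le_iInf fun u => le_iInf fun g => le_iInf fun ρ => le_iInf fun h => ?_
  rw [h.pairEnergy_eq hβ hE]
  have hnn : 0 ≤ ∫ x, permittivity β E x * ‖g x‖ ^ 2 :=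
    integral_nonneg fun x => permittivity_mul_sq_nonneg hβ E x _
  have hqmp := Measure.quasiMeasurePreserving_smul (volume : Measure (Space n))
    (inv_ne_zero hc.ne')
  let ρ' : Space n → ℝ := fun x => (c ^ n)⁻¹ * ρ (c⁻¹ • x)
  have hρ'm : AEStronglyMeasurable ρ' volume :=
    (h.memLp.1.comp_quasiMeasurePreserving hqmp).const_mul _
  have hρ'i : Integrable ρ' volume := by
    refine Integrable.const_mul ?_ _
    exact (integrable_comp_smul_iff volume ρ (inv_ne_zero hc.ne')).2 h.integrable
  have hρ'2 : MemLp ρ' 2 volume := by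
    rw [memLp_two_iff_integrable_sq hρ'm]
    simp only [ρ', mul_pow]
    refine Integrable.const_mul ?_ _
    exact (integrable_comp_smul_iff volume (fun x => ρ x ^ 2) (inv_ne_zero hc.ne')).2
      h.memLp.integrable_sq
  have key := chargeEnergy_le_of_bound_integral hn (K := K) (C := c * √((c ^ n)⁻¹) *
    √(∫ x, permittivity β E x * ‖g x‖ ^ 2)) hβ hcE hρ'2 ?_ hρ'i ?_ (by positivity) ?_
  · refine key.trans ?_
    have h2 : ∫ x, ρ' x ^ 2 = (c ^ n)⁻¹ * ∫ x, ρ x ^ 2 := by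
      simp only [ρ', mul_pow]
      rw [integral_const_mul, hscale' fun x => ρ x ^ 2]
      field_simp
    rw [h2, mul_pow, mul_pow, Real.sq_sqrt (by positivity), Real.sq_sqrt hnn, mul_add,
      mul_left_comm (ENNReal.ofReal (c ^ n)⁻¹),
      ← ENNReal.ofReal_mul (by positivity : 0 ≤ (c ^ n)⁻¹),
      ← ENNReal.ofReal_mul (by positivity : 0 ≤ (c ^ n)⁻¹)]
    gcongr
    calc c ^ 2 * (c ^ n)⁻¹ ≤ 1 * (c ^ n)⁻¹ := by gcongr; exact pow_le_one₀ hc.le hc1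
      _ = (c ^ n)⁻¹ := one_mul _
  · have h0 := hqmp.ae h.eq_zero_off
    filter_upwards [h0] with x hx hxE
    rw [Set.mem_smul_set_iff_inv_smul_mem₀ hc.ne'] at hxE
    simp [ρ', hx hxE]
  · rw [integral_const_mul, hscale' ρ, h.integral_eq_one]
    field_simp
  · intro ψ hψ
    have hψc := hψ.comp_smul hc.ne'
    have h1 : ∫ x, ρ' x * ψ x = ∫ x, ρ x * ψ (c • x) := by
      have : ∀ x, ρ' x * ψ x = (c ^ n)⁻¹ * (fun y => ρ y * ψ (c • y)) (c⁻¹ • x) := fun x => by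
        simp [ρ', smul_inv_smul₀ hc.ne', mul_assoc]
      simp_rw [this]
      rw [integral_const_mul, hscale' fun y => ρ y * ψ (c • y)]
      field_simp
    have h2 : ∫ x, permittivity β E x * ‖gradient (fun x => ψ (c • x)) x‖ ^ 2 =
        c ^ 2 * (c ^ n)⁻¹ * ∫ x, permittivity β (c • E) x * ‖gradient ψ x‖ ^ 2 := by
      have : ∀ x, permittivity β E x * ‖gradient (fun x => ψ (c • x)) x‖ ^ 2 =
          c ^ 2 * (fun y => permittivity β (c • E) y * ‖gradient ψ y‖ ^ 2) (c • x) := fun x => by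
        have hp : permittivity β (c • E) (c • x) = permittivity β E x := by
          by_cases hx : x ∈ E
          · rw [permittivity_of_mem hx, permittivity_of_mem (Set.smul_mem_smul_set hx)]
          · rw [permittivity_of_notMem hx, permittivity_of_notMem
              (by rwa [Set.smul_mem_smul_set_iff₀ hc.ne'])]
        simp only [gradient_comp_smul, norm_smul, hp, mul_pow, Real.norm_eq_abs, sq_abs]
        ring
      simp_rw [this]
      rw [integral_const_mul, hscale fun y => permittivity β (c • E) y * ‖gradient ψ y‖ ^ 2,
        mul_assoc]
    rw [h1, ← h.weak_eq _ hψc]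
    refine (abs_integral_permittivity_inner_le hβ hE h.hasD1Gradient.memLp_grad
      (hψc.memLp_gradient 2)).trans (le_of_eq ?_)
    rw [h2, Real.sqrt_mul (by positivity), Real.sqrt_mul (by positivity), Real.sqrt_sq hc.le]
    ring

/-- The charge energy of the unit ball is controlled, by the uniform charge distribution and the
Sobolev inequality. -/
theorem exists_chargeEnergy_ball_le (hn : 3 ≤ n) : ∃ C : ℝ, ∀ β K : ℝ, 1 ≤ β →
    chargeEnergy β K (Metric.ball (0 : Space n) 1) ≤ ENNReal.ofReal (C ^ 2) +
      ENNReal.ofReal K * ENNReal.ofReal ((volume.real (Metric.ball (0 : Space n) 1))⁻¹) := by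
  obtain ⟨S, hS⟩ := exists_sobolev_const hn
  set B := Metric.ball (0 : Space n) 1 with hB
  set w := volume.real B with hw
  have hBfin : volume B ≠ ∞ := measure_ball_lt_top.ne
  have hw0 : 0 < w := ENNReal.toReal_pos (Metric.measure_ball_pos volume _ one_pos).ne' hBfin
  set p := sobolevExponent n with hp
  have hp1 : 1 ≤ p := one_le_sobolevExponent hn
  let M : ℝ≥0∞ := volume B ^ (1 / (1 : ℝ≥0∞).toReal - 1 / p.toReal)
  have hM : M ≠ ∞ := ENNReal.rpow_ne_top_of_nonneg (by
    have : 1 ≤ p.toReal := by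
      rw [← ENNReal.toReal_one]
      exact ENNReal.toReal_mono ENNReal.ofReal_ne_top hp1
    rw [sub_nonneg, ENNReal.toReal_one]
    exact one_div_le_one_div_of_le one_pos this) hBfin
  refine ⟨w⁻¹ * (S * M.toReal), fun β K hβ => ?_⟩
  have hBm : MeasurableSet B := Metric.isOpen_ball.measurableSet
  let ρ : Space n → ℝ := B.indicator fun _ => w⁻¹
  have hρ : ∀ p, MemLp ρ p volume := fun p => memLp_indicator_const p hBm _ (Or.inr hBfin)
  have h2 : ∫ x, ρ x ^ 2 = w⁻¹ := by
    have : ∀ x, ρ x ^ 2 = B.indicator (fun _ => w⁻¹ ^ 2) x := fun x => by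
      by_cases hx : x ∈ B <;> simp [ρ, hx]
    simp_rw [this]
    rw [integral_indicator_const _ hBm, ← hw, smul_eq_mul]
    field_simp
  rw [← h2]
  refine chargeEnergy_le_of_bound_integral hn hβ hBm.nullMeasurableSet (hρ 2)
    (Eventually.of_forall fun x hx => by simp [ρ, hx]) (memLp_one_iff_integrable.1 (hρ 1)) ?_
    (by positivity) fun ψ hψ => ?_
  · rw [integral_indicator_const _ hBm, ← hw, smul_eq_mul, mul_inv_cancel₀ hw0.ne']
  have hg2 := hψ.memLp_gradient 2
  have e1 : ∫ x, ρ x * ψ x = w⁻¹ * ∫ x in B, ψ x := by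
    rw [← integral_const_mul, ← integral_indicator hBm]
    congr 1
    ext x
    by_cases hx : x ∈ B <;> simp [ρ, hx]
  have e2 : |∫ x in B, ψ x| ≤ (eLpNorm ψ 1 (volume.restrict B)).toReal := by
    have hi := (hψ.memLp 1).restrict B
    rw [eLpNorm_one_eq_lintegral_enorm, ← integral_norm_eq_lintegral_enorm hi.1]
    exact norm_integral_le_integral_norm (μ := volume.restrict B) ψ
  have e3 : eLpNorm ψ 1 (volume.restrict B) ≤ S * M * eLpNorm (gradient ψ) 2 volume := by
    calc _ ≤ eLpNorm ψ p (volume.restrict B) * M := by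
          have := eLpNorm_le_eLpNorm_mul_rpow_measure_univ hp1 ((hψ.memLp 1).restrict B).1
          rwa [Measure.restrict_apply_univ] at this
      _ ≤ eLpNorm ψ p volume * M := by
          gcongr
          exact Measure.restrict_le_self
      _ ≤ S * eLpNorm (gradient ψ) 2 volume * M := by gcongr; exact hS ψ hψ
      _ = _ := by ring
  have e4 : (eLpNorm (gradient ψ) 2 volume).toReal ≤
      √(∫ x, permittivity β B x * ‖gradient ψ x‖ ^ 2) := by
    have hi := hg2.integrable_norm_pow (by norm_num)
    have : (eLpNorm (gradient ψ) 2 volume).toReal = √(∫ x, ‖gradient ψ x‖ ^ 2) := by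
      rw [toReal_eLpNorm hg2.1, lpNorm_eq_integral_norm_rpow_toReal (by simp) (by simp) hg2.1]
      simp [Real.sqrt_eq_rpow]
    rw [this]
    refine Real.sqrt_le_sqrt (integral_mono hi
      (integrable_permittivity_mul hβ hBm.nullMeasurableSet hi) fun x => ?_)
    exact le_mul_of_one_le_left (by positivity) (one_le_permittivity hβ B x)
  have e5 := ENNReal.toReal_mono
    (ENNReal.mul_ne_top (ENNReal.mul_ne_top ENNReal.coe_ne_top hM) hg2.2.ne) e3
  rw [ENNReal.toReal_mul, ENNReal.toReal_mul, ENNReal.coe_toReal] at e5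
  rw [e1, abs_mul, abs_of_pos (inv_pos.2 hw0), h2, mul_assoc w⁻¹]
  refine mul_le_mul_of_nonneg_left ?_ (by positivity)
  calc _ ≤ _ := e2.trans e5
    _ ≤ _ := by gcongr

end

/-! ### The divergence and the perimeter -/

section divergence

variable {T S : Space n → Space n} {η : Space n → ℝ}

lemma divergence_add (hT : ContDiff ℝ 1 T) (hS : ContDiff ℝ 1 S) (x : Space n) :
    divergence (fun x => T x + S x) x = divergence T x + divergence S x := by
  simp [divergence, fderiv_fun_add (hT.differentiable one_ne_zero x)
    (hS.differentiable one_ne_zero x), Finset.sum_add_distrib]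

lemma divergence_sub (hT : ContDiff ℝ 1 T) (hS : ContDiff ℝ 1 S) (x : Space n) :
    divergence (fun x => T x - S x) x = divergence T x - divergence S x := by
  simp [divergence, fderiv_fun_sub (hT.differentiable one_ne_zero x)
    (hS.differentiable one_ne_zero x), Finset.sum_sub_distrib]

lemma sum_smul_single (v : Space n) : ∑ i, v i • EuclideanSpace.single i (1 : ℝ) = v := by
  ext j
  simp [Pi.single_apply]

lemma divergence_smul (hη : ContDiff ℝ 1 η) (hT : ContDiff ℝ 1 T) (x : Space n) :
    divergence (fun x => η x • T x) x = η x * divergence T x + fderiv ℝ η x (T x) := by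
  conv_rhs => rw [← sum_smul_single (T x)]
  simp only [divergence, fderiv_fun_smul (hη.differentiable one_ne_zero x)
    (hT.differentiable one_ne_zero x), map_sum, map_smul, Finset.mul_sum]
  rw [← Finset.sum_add_distrib]
  refine Finset.sum_congr rfl fun i _ => ?_
  simp [mul_comm]

lemma divergence_const_smul (c : ℝ) (hT : ContDiff ℝ 1 T) (x : Space n) :
    divergence (fun x => c • T x) x = c * divergence T x := by
  simpa using divergence_smul (contDiff_const (c := c)) hT x

lemma divergence_smul_sub (c : ℝ) (y x : Space n) :
    divergence (fun x => c • (x - y)) x = n * c := by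
  rw [divergence_const_smul (T := fun x => x - y) c (contDiff_id.sub contDiff_const)]
  have h : fderiv ℝ (fun x : Space n => x - y) x = ContinuousLinearMap.id ℝ _ :=
    (hasFDerivAt_sub_const y).fderiv
  simp [divergence, h, mul_comm]

lemma divergence_smul_const (hη : ContDiff ℝ 1 η) (v x : Space n) :
    divergence (fun x => η x • v) x = fderiv ℝ η x v := by
  rw [divergence_smul hη contDiff_const]
  simp [divergence]

lemma divergence_comp_smul (c : ℝ) (x : Space n) :
    divergence (fun x => T (c • x)) x = c * divergence T (c • x) := by
  simp [divergence, fderiv_comp_smul, Finset.mul_sum]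

lemma continuous_divergence (hT : ContDiff ℝ 1 T) : Continuous (divergence T) := by
  have h := hT.continuous_fderiv one_ne_zero
  unfold divergence
  fun_prop

lemma hasCompactSupport_divergence (hTc : HasCompactSupport T) :
    HasCompactSupport (divergence T) :=
  (hTc.fderiv (𝕜 := ℝ)).comp_left (g := fun L : Space n →L[ℝ] Space n =>
    ∑ i : Fin n, (L (EuclideanSpace.single i 1)) i) (by simp)

lemma integrable_divergence (hT : ContDiff ℝ 1 T) (hTc : HasCompactSupport T) :
    Integrable (divergence T) volume :=
  (continuous_divergence hT).integrable_of_hasCompactSupport (hasCompactSupport_divergence hTc)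

/-- The divergence theorem for compactly supported fields. -/
lemma integral_divergence_eq_zero (hT : ContDiff ℝ 1 T) (hTc : HasCompactSupport T) :
    ∫ x, divergence T x = 0 := by
  have hint : ∀ v, Integrable (fun x => fderiv ℝ T x v) volume := fun v =>
    ((hT.continuous_fderiv one_ne_zero).clm_apply continuous_const).integrable_of_hasCompactSupport
      ((hTc.fderiv (𝕜 := ℝ)).comp_left (g := fun L : Space n →L[ℝ] Space n => L v) (by simp))
  have hv : ∀ v, ∫ x, fderiv ℝ T x v = 0 := fun v => by
    have := integral_smul_fderiv_eq_neg_fderiv_smul_of_integrable (μ := volume)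
      (f := fun _ : Space n => (1 : ℝ)) (g := T) (v := v) (by simp) (by simpa using hint v)
      (by simpa using hT.continuous.integrable_of_hasCompactSupport hTc) (by simp)
      (fun x _ => hT.differentiable one_ne_zero x)
    simpa using this
  unfold divergence
  rw [integral_finsetSum]
  · refine Finset.sum_eq_zero fun i _ => ?_
    have := (EuclideanSpace.proj (𝕜 := ℝ) i).integral_comp_comm
      (hint (EuclideanSpace.single i 1))
    simpa [hv] using this
  · intro i _
    exact (EuclideanSpace.proj (𝕜 := ℝ) i).integrable_comp (hint (EuclideanSpace.single i 1))

end divergence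

section perimeter

variable {E F : Set (Space n)}

lemma perimeter_congr (h : E =ᵐ[volume] F) : perimeter E = perimeter F := by
  unfold perimeter
  simp_rw [setIntegral_congr_set h]

lemma setIntegral_divergence_le (hP : perimeter E ≠ ∞) {T : Space n → Space n}
    (hT : ContDiff ℝ 1 T) (hTc : HasCompactSupport T) {M : ℝ} (hM : 0 < M)
    (hTM : ∀ x, ‖T x‖ ≤ M) : ∫ x in E, divergence T x ≤ M * (perimeter E).toReal := by
  have h1 : ENNReal.ofReal (∫ x in E, divergence (fun x => M⁻¹ • T x) x) ≤ perimeter E :=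
    le_iSup₂_of_le (f := fun (T : Space n → Space n)
      (_ : ContDiff ℝ 1 T ∧ HasCompactSupport T ∧ ∀ x, ‖T x‖ ≤ 1) =>
        ENNReal.ofReal (∫ x in E, divergence T x)) (fun x => M⁻¹ • T x)
      ⟨contDiff_const.fun_smul hT, hTc.smul_left (f := fun _ => M⁻¹), fun x => by
        rw [norm_smul, Real.norm_of_nonneg (by positivity), inv_mul_le_iff₀ hM, mul_one]
        exact hTM x⟩ le_rfl
  have h2 := (ENNReal.ofReal_le_iff_le_toReal hP).1 h1
  simp_rw [divergence_const_smul M⁻¹ hT] at h2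
  rw [integral_const_mul, inv_mul_le_iff₀ hM] at h2
  exact h2

lemma perimeter_le_of_forall {a : ℝ≥0∞}
    (h : ∀ T : Space n → Space n, ContDiff ℝ 1 T → HasCompactSupport T → (∀ x, ‖T x‖ ≤ 1) →
      ENNReal.ofReal (∫ x in E, divergence T x) ≤ a) : perimeter E ≤ a :=
  iSup₂_le fun T hT => h T hT.1 hT.2.1 hT.2.2

/-- The sum of two perimeters is bounded by testing both with a pair of fields. -/
lemma perimeter_add_perimeter_le {c : ℝ}
    (h : ∀ T S : Space n → Space n, ContDiff ℝ 1 T → HasCompactSupport T → (∀ x, ‖T x‖ ≤ 1) →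
      ContDiff ℝ 1 S → HasCompactSupport S → (∀ x, ‖S x‖ ≤ 1) →
      (∫ x in E, divergence T x) + (∫ x in F, divergence S x) ≤ c) :
    perimeter E + perimeter F ≤ ENNReal.ofReal c := by
  have h00 : ContDiff ℝ 1 (fun _ : Space n => (0 : Space n)) := contDiff_const
  have h0c : HasCompactSupport (fun _ : Space n => (0 : Space n)) := HasCompactSupport.zero
  have h0 : ∀ x : Space n, ‖(fun _ : Space n => (0 : Space n)) x‖ ≤ 1 := fun x => by simp
  have hd : ∀ A : Set (Space n), ∫ x in A, divergence (fun _ : Space n => (0 : Space n)) x = 0 := by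
    simp [divergence]
  refine ENNReal.biSup_add_biSup_le' ⟨fun _ => 0, h00, h0c, h0⟩ ⟨fun _ => 0, h00, h0c, h0⟩
    fun T hT S hS => ?_
  rcases le_total 0 (∫ x in E, divergence T x) with hE | hE <;>
  rcases le_total 0 (∫ x in F, divergence S x) with hF | hF
  · rw [← ENNReal.ofReal_add hE hF]
    exact ENNReal.ofReal_le_ofReal (h T S hT.1 hT.2.1 hT.2.2 hS.1 hS.2.1 hS.2.2)
  · rw [ENNReal.ofReal_of_nonpos hF, add_zero]
    have := h T _ hT.1 hT.2.1 hT.2.2 h00 h0c h0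
    rw [hd, add_zero] at this
    exact ENNReal.ofReal_le_ofReal this
  · rw [ENNReal.ofReal_of_nonpos hE, zero_add]
    have := h _ S h00 h0c h0 hS.1 hS.2.1 hS.2.2
    rw [hd, zero_add] at this
    exact ENNReal.ofReal_le_ofReal this
  · rw [ENNReal.ofReal_of_nonpos hE, ENNReal.ofReal_of_nonpos hF, zero_add]
    exact zero_le

open scoped Pointwise

lemma perimeter_smul_le {c : ℝ} (hn : 1 ≤ n) (hc : 0 < c) (hc1 : c ≤ 1) :
    perimeter (c • E) ≤ perimeter E := by
  refine perimeter_le_of_forall fun T hT hTc hT1 => ?_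
  have hS : ContDiff ℝ 1 fun x => T (c • x) := hT.comp (contDiff_const_smul c)
  have hSc : HasCompactSupport fun x => T (c • x) :=
    hTc.comp_homeomorph (Homeomorph.smulOfNeZero c hc.ne')
  have h1 : ∫ x in c • E, divergence T x =
      c ^ (n - 1) * ∫ x in E, divergence (fun x => T (c • x)) x := by
    have := Measure.setIntegral_comp_smul_of_pos volume (divergence T) E hc
    rw [finrank_euclideanSpace, Fintype.card_fin, smul_eq_mul] at this
    simp_rw [divergence_comp_smul]
    rw [integral_const_mul, this]
    obtain ⟨m, rfl⟩ : ∃ m, n = m + 1 := ⟨n - 1, by omega⟩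
    rw [Nat.add_sub_cancel, pow_succ]
    field_simp
  rw [h1, ENNReal.ofReal_mul (by positivity)]
  calc _ ≤ ENNReal.ofReal 1 * perimeter E := by
        gcongr
        · exact pow_le_one₀ hc.le hc1
        · exact le_iSup₂_of_le (f := fun (T : Space n → Space n)
            (_ : ContDiff ℝ 1 T ∧ HasCompactSupport T ∧ ∀ x, ‖T x‖ ≤ 1) =>
            ENNReal.ofReal (∫ x in E, divergence T x)) _ ⟨hS, hSc, fun x => hT1 _⟩ le_rfl
    _ = perimeter E := by simp

end perimeter

/-! ### Translation estimate and isoperimetric inequality -/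

section translation

variable {E : Set (Space n)}

/-- Moving a test function by `h` changes its integral over `E` by at most `‖h‖ P(E)`: the
derivative of `∫_E ψ(x - t h) dx` in `t` is minus the integral over `E` of the divergence of
`ψ(x - t h) h`. -/
lemma abs_setIntegral_translate_sub_le (hvol : volume E ≠ ∞) (hP : perimeter E ≠ ∞)
    {ψ : Space n → ℝ} (hψ : ContDiff ℝ 1 ψ) (hψc : HasCompactSupport ψ) (hψ1 : ∀ x, |ψ x| ≤ 1)
    (h : Space n) :
    |(∫ x in E, ψ (x - h)) - ∫ x in E, ψ x| ≤ ‖h‖ * (perimeter E).toReal := by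
  rcases eq_or_ne h 0 with rfl | hh
  · simp
  have hdc : Continuous (fderiv ℝ ψ) := hψ.continuous_fderiv one_ne_zero
  obtain ⟨M, hM⟩ := hdc.bounded_above_of_compact_support (hψc.fderiv (𝕜 := ℝ))
  have hfin : IsFiniteMeasure (volume.restrict E) := ⟨by simpa using hvol.lt_top⟩
  let f : ℝ → ℝ := fun t => ∫ x in E, ψ (x - t • h)
  have hder : ∀ t, HasDerivAt f (∫ x in E, fderiv ℝ ψ (x - t • h) (-h)) t := fun t => by
    refine (hasDerivAt_integral_of_dominated_loc_of_deriv_le (s := Set.univ)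
      (F := fun t x => ψ (x - t • h)) (F' := fun t x => fderiv ℝ ψ (x - t • h) (-h))
      (bound := fun _ => M * ‖h‖) univ_mem ?_ ?_ ?_ ?_ ?_ ?_).2
    · exact Eventually.of_forall fun t =>
        (hψ.continuous.comp (by fun_prop)).aestronglyMeasurable
    · refine Integrable.of_bound (hψ.continuous.comp (by fun_prop)).aestronglyMeasurable 1
        (Eventually.of_forall fun x => hψ1 _)
    · exact ((hdc.comp (by fun_prop)).clm_apply continuous_const).aestronglyMeasurable
    · refine Eventually.of_forall fun x t _ => ?_
      calc _ ≤ ‖fderiv ℝ ψ (x - t • h)‖ * ‖-h‖ := ContinuousLinearMap.le_opNorm _ _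
        _ ≤ M * ‖h‖ := by rw [norm_neg]; gcongr; exact hM _
    · exact integrable_const _
    · refine Eventually.of_forall fun x t _ => ?_
      have h1 : HasDerivAt (fun t : ℝ => x - t • h) (-h) t := by
        simpa using ((hasDerivAt_id t).smul_const h).const_sub x
      exact (hψ.differentiable one_ne_zero _).hasFDerivAt.comp_hasDerivAt t h1
  have hbd : ∀ t : ℝ, ‖∫ x in E, fderiv ℝ ψ (x - t • h) (-h)‖ ≤ ‖h‖ * (perimeter E).toReal := by
    have key : ∀ t : ℝ, ∀ v : Space n, ‖v‖ = ‖h‖ →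
        ∫ x in E, fderiv ℝ ψ (x - t • h) v ≤ ‖h‖ * (perimeter E).toReal := fun t v hv => by
      have hc : ContDiff ℝ 1 fun x => ψ (x - t • h) := hψ.comp (contDiff_id.sub contDiff_const)
      have hcc : HasCompactSupport fun x => ψ (x - t • h) :=
        hψc.comp_homeomorph (Homeomorph.subRight (t • h))
      have := setIntegral_divergence_le hP (T := fun x => ψ (x - t • h) • v)
        (hc.smul contDiff_const) hcc.smul_right (norm_pos_iff.2 hh) (fun x => by
          rw [norm_smul, hv]
          exact mul_le_of_le_one_left (norm_nonneg _) (hψ1 _))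
      simp_rw [divergence_smul_const hc, fderiv_comp_sub] at this
      exact this
    intro t
    rw [Real.norm_eq_abs, abs_le]
    refine ⟨?_, key t (-h) (norm_neg h)⟩
    have := key t h rfl
    simp only [map_neg, integral_neg]
    linarith
  have := norm_image_sub_le_of_norm_deriv_le_segment_01' (f := f)
    (f' := fun t => ∫ x in E, fderiv ℝ ψ (x - t • h) (-h))
    (fun t _ => (hder t).hasDerivWithinAt) (fun t _ => hbd t)
  simpa [f] using this

/-- Indicator functions of null measurable sets of finite measure can be tested by `C¹` functions
with values in `[0, 1]`. -/
lemma exists_contDiff_approx {A : Set (Space n)} (hA : NullMeasurableSet A volume)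
    (hAfin : volume A ≠ ∞) {ε : ℝ} (hε : 0 < ε) :
    ∃ K U : Set (Space n), ∃ ψ : Space n → ℝ, IsCompact K ∧ IsOpen U ∧ K ⊆ A ∧ K ⊆ U ∧
      volume.real A ≤ volume.real K + ε ∧ volume.real (U \ K) ≤ ε ∧ volume (U \ K) ≠ ∞ ∧
      ContDiff ℝ 1 ψ ∧ HasCompactSupport ψ ∧ (∀ x, 0 ≤ ψ x ∧ ψ x ≤ 1) ∧
      (∀ x ∈ K, ψ x = 1) ∧ ∀ x ∉ U, ψ x = 0 := by
  obtain ⟨A', hA'A, hA'm, hA'e⟩ := hA.exists_measurable_subset_ae_eq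
  have hA'fin : volume A' ≠ ∞ := by rwa [measure_congr hA'e]
  obtain ⟨K, hKA, hK, hKε⟩ := hA'm.exists_isCompact_lt_add hA'fin
    (ε := ENNReal.ofReal ε) (ENNReal.ofReal_pos.2 hε).ne'
  have hKfin : volume K ≠ ∞ := hK.measure_lt_top.ne
  obtain ⟨V, hKV, hV, hVε⟩ := K.exists_isOpen_lt_add (μ := volume) hKfin
    (ε := ENNReal.ofReal ε) (ENNReal.ofReal_pos.2 hε).ne'
  obtain ⟨R, hR⟩ := hK.isBounded.subset_ball 0
  let U := V ∩ Metric.ball 0 R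
  have hU : IsOpen U := hV.inter Metric.isOpen_ball
  have hKU : K ⊆ U := Set.subset_inter hKV hR
  have hUfin : volume U ≠ ∞ :=
    ((measure_mono Set.inter_subset_right).trans_lt measure_ball_lt_top).ne
  obtain ⟨ψ, hψ0, hψ1, hψ⟩ := exists_contMDiffMap_zero_one_of_isClosed
    (n := 1) (modelWithCornersSelf ℝ (Space n)) (s := Uᶜ) (t := K) hU.isClosed_compl hK.isClosed
    (Set.disjoint_left.2 fun x hx hxK => hx (hKU hxK))
  have hUK : volume (U \ K) ≤ ENNReal.ofReal ε := by
    rw [measure_sdiff hKU hK.measurableSet.nullMeasurableSet hKfin, tsub_le_iff_left]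
    exact (measure_mono Set.inter_subset_left).trans hVε.le
  refine ⟨K, U, ψ, hK, hU, hKA.trans hA'A, hKU, ?_, ?_, ?_, ψ.contMDiff.contDiff, ?_,
    fun x => hψ x, fun x hx => hψ1 hx, fun x hx => hψ0 hx⟩
  · rw [measureReal_congr hA'e.symm]
    have := ENNReal.toReal_mono (by simp [hKfin]) hKε.le
    rwa [ENNReal.toReal_add hKfin (by simp), ENNReal.toReal_ofReal hε.le] at this
  · exact ENNReal.toReal_le_of_le_ofReal hε.le hUK
  · exact (hUK.trans_lt (by simp)).ne
  · refine HasCompactSupport.intro (isCompact_closedBall (0 : Space n) R) fun x hx => hψ0 ?_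
    intro hxU
    exact hx (Metric.ball_subset_closedBall hxU.2)

/-- The part of `E` that the translation by `h` moves out of `E` has measure at most
`‖h‖ P(E)`. -/
theorem measureReal_diff_translate_le (hE : NullMeasurableSet E volume) (hvol : volume E ≠ ∞)
    (hP : perimeter E ≠ ∞) (h : Space n) :
    volume.real (E \ (fun x => x + h) ⁻¹' E) ≤ ‖h‖ * (perimeter E).toReal := by
  have hmp := measurePreserving_add_right (volume : Measure (Space n)) h
  set E' := (fun x => x + h) ⁻¹' E with hE'
  have hE'm : NullMeasurableSet E' volume := hE.preimage hmp.quasiMeasurePreserving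
  refine le_of_forall_pos_le_add fun ε hε => ?_
  obtain ⟨K, U, ψ, hK, hU, hKA, hKU, h1, h2, h2', hψ, hψc, hψ01, hψK, hψU⟩ :=
    exists_contDiff_approx (hE.diff hE'm)
      ((measure_mono Set.sdiff_subset).trans_lt hvol.lt_top).ne (half_pos hε)
  have htr : ∫ x in E, ψ (x - h) = ∫ x in E', ψ x := by
    have := hmp.setIntegral_preimage_emb (measurableEmbedding_addRight h) (fun x => ψ (x - h)) E
    simpa using this.symm
  have habs := abs_setIntegral_translate_sub_le hvol hP hψ hψc
    (fun x => by rw [abs_of_nonneg (hψ01 x).1]; exact (hψ01 x).2) h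
  rw [htr] at habs
  have hψi := hψ.continuous.integrable_of_hasCompactSupport hψc (μ := volume)
  have hlow : volume.real K ≤ ∫ x in E, ψ x := by
    calc volume.real K = ∫ x in K, ψ x := by
          rw [setIntegral_congr_fun hK.measurableSet hψK]; simp
      _ ≤ ∫ x in E, ψ x := setIntegral_mono_set hψi.integrableOn
          (Eventually.of_forall fun x => (hψ01 x).1)
          (Eventually.of_forall fun x hx => (hKA hx).1)
  have hup : ∫ x in E', ψ x ≤ ε / 2 := by
    calc ∫ x in E', ψ x = ∫ x, E'.indicator ψ x := (integral_indicator₀ hE'm).symm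
      _ ≤ ∫ x, (U \ K).indicator (fun _ => (1 : ℝ)) x := by
          refine integral_mono (hψi.indicator₀ hE'm)
            ((integrable_indicator_iff (hU.measurableSet.diff hK.measurableSet)).2
              (integrableOn_const h2')) fun x => ?_
          by_cases hx : x ∈ U \ K
          · rw [Set.indicator_of_mem hx]
            by_cases hxE : x ∈ E'
            · rw [Set.indicator_of_mem hxE]; exact (hψ01 x).2
            · rw [Set.indicator_of_notMem hxE]; exact zero_le_one
          · rw [Set.indicator_of_notMem hx]
            by_cases hxE : x ∈ E'
            · rw [Set.indicator_of_mem hxE]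
              refine (hψU x fun hxU => hx ⟨hxU, fun hxK => (hKA hxK).2 hxE⟩).le
            · rw [Set.indicator_of_notMem hxE]
      _ = volume.real (U \ K) := by
          rw [integral_indicator_const _ (hU.measurableSet.diff hK.measurableSet)]; simp
      _ ≤ ε / 2 := h2
  have := (abs_le.1 habs).1
  linarith

end translation

section isoperimetric

variable {E : Set (Space n)}

lemma measureReal_ball (x : Space n) {r : ℝ} (hr : 0 < r) :
    volume.real (Metric.ball x r) = r ^ n * volume.real (Metric.ball (0 : Space n) 1) := by
  rw [measureReal_def, Measure.addHaar_ball_of_pos _ _ hr, ENNReal.toReal_mul,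
    ENNReal.toReal_ofReal (by positivity)]
  simp [measureReal_def]

lemma measureReal_unitBall_pos : 0 < volume.real (Metric.ball (0 : Space n) 1) :=
  ENNReal.toReal_pos (Metric.measure_ball_pos volume _ one_pos).ne' measure_ball_lt_top.ne

/-- The translation estimate averaged over all translations of length less than `s`. -/
theorem lintegral_ball_diff_le (hE : NullMeasurableSet E volume) (hvol : volume E ≠ ∞)
    (hP : perimeter E ≠ ∞) (s : ℝ) :
    ∫⁻ x in E, volume (Metric.ball x s \ E) ≤
      ENNReal.ofReal (s * (perimeter E).toReal) * volume (Metric.ball (0 : Space n) s) := by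
  wlog hEm : MeasurableSet E generalizing E
  · obtain ⟨E', -, hE'm, hE'e⟩ := hE.exists_measurable_subset_ae_eq
    have := this hE'm.nullMeasurableSet (by rwa [measure_congr hE'e])
      (by rwa [perimeter_congr hE'e]) hE'm
    rw [perimeter_congr hE'e, Measure.restrict_congr_set hE'e] at this
    convert this using 3 with x
    exact measure_congr ((ae_eq_refl _).diff hE'e.symm)
  have h1 : ∀ x, volume (Metric.ball x s \ E) =
      ∫⁻ h in Metric.ball (0 : Space n) s, Eᶜ.indicator 1 (x + h) := fun x => by
    have hpre : (fun h => x + h) ⁻¹' (Metric.ball x s \ E) =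
        ((fun h => x + h) ⁻¹' Eᶜ) ∩ Metric.ball 0 s := by
      ext h
      simp [and_comm]
    have hm : MeasurableSet ((fun h => x + h) ⁻¹' Eᶜ) := measurable_const_add x hEm.compl
    rw [← measure_preimage_add volume x, hpre, ← Measure.restrict_apply hm,
      ← lintegral_indicator_one hm]
    rfl
  simp_rw [h1]
  rw [lintegral_lintegral_swap]
  · calc _ ≤ ∫⁻ _ in Metric.ball (0 : Space n) s, ENNReal.ofReal (s * (perimeter E).toReal) := by
          refine setLIntegral_mono measurable_const fun h hh => ?_
          have hm : MeasurableSet ((fun x => x + h) ⁻¹' Eᶜ) := measurable_add_const h hEm.compl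
          have h2 : ∫⁻ x in E, Eᶜ.indicator 1 (x + h) =
              volume (E \ (fun x => x + h) ⁻¹' E) := by
            rw [Set.sdiff_eq, Set.inter_comm, ← Set.preimage_compl, ← Measure.restrict_apply hm,
              ← lintegral_indicator_one hm]
            rfl
          rw [h2]
          refine (ENNReal.le_ofReal_iff_toReal_le
            ((measure_mono Set.sdiff_subset).trans_lt hvol.lt_top).ne ?_).2
            ((measureReal_diff_translate_le hE hvol hP h).trans ?_)
          · have := (norm_nonneg h).trans (mem_ball_zero_iff.1 hh).le
            positivity
          · gcongr
            exact (mem_ball_zero_iff.1 hh).le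
      _ = _ := by rw [setLIntegral_const]
  · exact ((measurable_one.indicator hEm.compl).comp measurable_add).aemeasurable

/-- If every ball of radius `s` about a point of `E` misses a fixed volume `c` of `E`, the perimeter
of `E` is large. -/
lemma mul_measureReal_le_of_forall_ball_diff (hE : NullMeasurableSet E volume)
    (hvol : volume E ≠ ∞) (hP : perimeter E ≠ ∞) {s c : ℝ} (hs : 0 ≤ s)
    (hc : ∀ x ∈ E, c ≤ volume.real (Metric.ball x s \ E)) :
    c * volume.real E ≤ s * (perimeter E).toReal * volume.real (Metric.ball (0 : Space n) s) := by
  rcases le_total c 0 with hc0 | hc0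
  · exact (mul_nonpos_of_nonpos_of_nonneg hc0 measureReal_nonneg).trans (by positivity)
  have h1 : ENNReal.ofReal c * volume E ≤ ∫⁻ x in E, volume (Metric.ball x s \ E) := by
    rw [← setLIntegral_const]
    refine lintegral_mono_ae ?_
    refine (ae_restrict_iff'₀ hE).2 (Eventually.of_forall fun x hx => ?_)
    exact ENNReal.ofReal_le_of_le_toReal (hc x hx)
  have h2 := ENNReal.toReal_mono (ENNReal.mul_ne_top ENNReal.ofReal_ne_top measure_ball_lt_top.ne)
    (h1.trans (lintegral_ball_diff_le hE hvol hP s))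
  rwa [ENNReal.toReal_mul, ENNReal.toReal_mul, ENNReal.toReal_ofReal hc0,
    ENNReal.toReal_ofReal (by positivity)] at h2

/-- The isoperimetric inequality, with a constant that is not sharp. It follows from the averaged
translation estimate on balls of twice the volume of `E`. -/
theorem isoperimetric (hn : 2 ≤ n) (hE : NullMeasurableSet E volume) (hvol : volume E ≠ ∞)
    (hP : perimeter E ≠ ∞) :
    volume.real (Metric.ball (0 : Space n) 1) * volume.real E ^ (n - 1) ≤
      2 ^ (n + 1) * (perimeter E).toReal ^ n := by
  set w := volume.real (Metric.ball (0 : Space n) 1)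
  set p := (perimeter E).toReal
  set v := volume.real E with hv
  have hw : 0 < w := measureReal_unitBall_pos
  have hp : 0 ≤ p := ENNReal.toReal_nonneg
  have hv0 : 0 ≤ v := measureReal_nonneg
  rcases hv0.eq_or_lt with h0 | h0
  · rw [← h0, zero_pow (by omega), mul_zero]
    positivity
  -- Balls of radius `s` have twice the volume of `E`.
  set s : ℝ := (2 * v / w) ^ ((n : ℝ)⁻¹)
  have hs : 0 < s := by positivity
  have hsn : s ^ n = 2 * v / w := Real.rpow_inv_natCast_pow (by positivity) (by omega)
  have hball : ∀ x : Space n, volume.real (Metric.ball x s) = 2 * v := fun x => by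
    rw [measureReal_ball x hs, hsn]
    field_simp
    rfl
  have key := mul_measureReal_le_of_forall_ball_diff hE hvol hP (c := v) hs.le fun x _ => by
    have := le_measureReal_sdiff (μ := volume) (s₁ := Metric.ball x s) (s₂ := E) hvol
    rw [hball x, ← hv] at this
    linarith
  rw [hball 0, ← hv] at key
  have h1 : v ≤ 2 * (s * p) := by
    refine le_of_mul_le_mul_right ?_ h0
    linarith
  have h2 : v ^ n ≤ 2 ^ n * (2 * v / w * p ^ n) := by
    rw [← hsn, ← mul_pow, ← mul_pow]
    gcongr
  obtain ⟨m, rfl⟩ : ∃ m, n = m + 1 := ⟨n - 1, by omega⟩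
  rw [Nat.add_sub_cancel]
  rw [pow_succ] at h2
  refine le_of_mul_le_mul_right ?_ h0
  calc w * v ^ m * v = w * (v ^ m * v) := by ring
    _ ≤ w * (2 ^ (m + 1) * (2 * v / w * p ^ (m + 1))) := by gcongr
    _ = _ := by field_simp; ring

end isoperimetric

/-! ### Cutting and filling along balls -/

/-- Radial `C¹` cutoff functions between two concentric balls; `k` is the factor in
`∇η = -k (x - y)`. -/
lemma exists_radial_cutoff (n : ℕ) : ∃ M : ℝ, 0 < M ∧ ∀ (y : Space n) (t s : ℝ), 0 < t → t < s →
    ∃ η k : Space n → ℝ, ContDiff ℝ 1 η ∧ HasCompactSupport η ∧ (∀ x, 0 ≤ η x ∧ η x ≤ 1) ∧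
      (∀ x, ‖x - y‖ ≤ t → η x = 1) ∧ (∀ x, s ≤ ‖x - y‖ → η x = 0) ∧ (∀ x, 0 ≤ k x) ∧
      (∀ x v, fderiv ℝ η x v = -(k x * inner ℝ (x - y) v)) ∧
      (∀ x, k x * ‖x - y‖ ≤ M / (s - t)) ∧ ∀ x, k x ≠ 0 → t < ‖x - y‖ ∧ ‖x - y‖ < s := by
  have hχ : ContDiff ℝ 1 Real.smoothTransition := Real.smoothTransition.contDiff
  have hχd := hχ.differentiable one_ne_zero
  have hd0 : ∀ u, u ≤ 0 → deriv Real.smoothTransition u = 0 := fun u hu => by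
    refine IsLocalMin.deriv_eq_zero (Eventually.of_forall fun v => ?_)
    rw [Real.smoothTransition.zero_of_nonpos hu]
    exact Real.smoothTransition.nonneg v
  have hd1 : ∀ u, 1 ≤ u → deriv Real.smoothTransition u = 0 := fun u hu => by
    refine IsLocalMax.deriv_eq_zero (Eventually.of_forall fun v => ?_)
    rw [Real.smoothTransition.one_of_one_le hu]
    exact Real.smoothTransition.le_one v
  obtain ⟨M, hM⟩ := (hχ.continuous_deriv le_rfl).bounded_above_of_compact_support
    (HasCompactSupport.intro (isCompact_Icc (a := (0 : ℝ)) (b := 1)) fun u hu => by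
      rcases lt_or_ge u 0 with h | h
      · exact hd0 u h.le
      · exact hd1 u (not_le.1 fun h1 => hu ⟨h, h1⟩).le)
  have hM0 : 0 ≤ M := (norm_nonneg _).trans (hM 0)
  refine ⟨2 * M + 1, by positivity, fun y t s ht hts => ?_⟩
  have hD : 0 < s ^ 2 - t ^ 2 := by nlinarith
  let q : Space n → ℝ := fun x => (s ^ 2 - ‖x - y‖ ^ 2) / (s ^ 2 - t ^ 2)
  have hq : ContDiff ℝ 1 q := by
    refine (contDiff_const.sub ?_).div_const _
    exact (contDiff_id.sub contDiff_const).norm_sq ℝ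
  have hq' : ∀ x v, fderiv ℝ q x v = -(2 * inner ℝ (x - y) v) / (s ^ 2 - t ^ 2) := fun x v => by
    have h1 : HasFDerivAt (fun x => ‖x - y‖ ^ 2) (2 • (innerSL ℝ (x - y)).comp
        (ContinuousLinearMap.id ℝ (Space n))) x := (hasFDerivAt_sub_const y).norm_sq
    have h2 : HasFDerivAt q _ x := (h1.const_sub (s ^ 2)).mul_const (s ^ 2 - t ^ 2)⁻¹
    rw [h2.fderiv]
    simp [inner_sub_left]
    ring
  have hq1 : ∀ x, ‖x - y‖ ≤ t → 1 ≤ q x := fun x hx => by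
    rw [le_div_iff₀ hD]
    nlinarith [norm_nonneg (x - y)]
  have hq0 : ∀ x, s ≤ ‖x - y‖ → q x ≤ 0 := fun x hx => by
    refine div_nonpos_of_nonpos_of_nonneg ?_ hD.le
    nlinarith [norm_nonneg (x - y)]
  have hsupp : ∀ x, 2 * deriv Real.smoothTransition (q x) / (s ^ 2 - t ^ 2) ≠ 0 →
      t < ‖x - y‖ ∧ ‖x - y‖ < s := fun x hx => by
    constructor
    · by_contra! h
      exact hx (by rw [hd1 _ (hq1 x h)]; simp)
    · by_contra! h
      exact hx (by rw [hd0 _ (hq0 x h)]; simp)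
  have hk0 : ∀ x, 0 ≤ 2 * deriv Real.smoothTransition (q x) / (s ^ 2 - t ^ 2) := fun x => by
    have := Real.smoothTransition.monotone.deriv_nonneg (x := q x)
    positivity
  refine ⟨fun x => Real.smoothTransition (q x),
    fun x => 2 * deriv Real.smoothTransition (q x) / (s ^ 2 - t ^ 2), hχ.comp hq, ?_,
    fun x => ⟨Real.smoothTransition.nonneg _, Real.smoothTransition.le_one _⟩,
    fun x hx => Real.smoothTransition.one_of_one_le (hq1 x hx),
    fun x hx => Real.smoothTransition.zero_of_nonpos (hq0 x hx), hk0, fun x v => ?_,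
    fun x => ?_, hsupp⟩
  · refine HasCompactSupport.intro (isCompact_closedBall y s) fun x hx => ?_
    refine Real.smoothTransition.zero_of_nonpos (hq0 x ?_)
    rw [Metric.mem_closedBall, dist_eq_norm] at hx
    exact (not_le.1 hx).le
  · have := ((hχd (q x)).hasDerivAt.comp_hasFDerivAt x
      (hq.differentiable one_ne_zero x).hasFDerivAt).fderiv
    have h2 : fderiv ℝ (fun x => Real.smoothTransition (q x)) x =
      deriv Real.smoothTransition (q x) • fderiv ℝ q x := this
    rw [h2, _root_.smul_apply, hq', smul_eq_mul]
    ring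
  · by_cases hx : 2 * deriv Real.smoothTransition (q x) / (s ^ 2 - t ^ 2) = 0
    · beta_reduce
      rw [hx, zero_mul]
      exact div_nonneg (by positivity) (sub_nonneg.2 hts.le)
    · have hxs := (hsupp x hx).2.le
      have hMx := (le_abs_self _).trans (hM (q x))
      have hpos : 0 < s - t := sub_pos.2 hts
      have hst : 0 < s + t := by linarith
      have h3 : s ^ 2 - t ^ 2 = (s - t) * (s + t) := by ring
      calc _ ≤ 2 * M / (s ^ 2 - t ^ 2) * (s + t) := by
            beta_reduce
            gcongr
            linarith
        _ = 2 * M / (s - t) := by rw [h3]; field_simp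
        _ ≤ _ := by gcongr; linarith

section cutoff

variable {F : Set (Space n)} {η : Space n → ℝ} {T S : Space n → Space n}

lemma setIntegral_divergence_cutoff (hF : NullMeasurableSet F volume) (hη : ContDiff ℝ 1 η)
    (hηc : HasCompactSupport η) (hS : ContDiff ℝ 1 S) :
    (∫ x in F, divergence (fun x => η x • S x) x) + (∫ x in Fᶜ, η x * divergence S x) +
      (∫ x in Fᶜ, fderiv ℝ η x (S x)) = 0 := by
  have hc : ContDiff ℝ 1 fun x => η x • S x := hη.smul hS
  have hcc : HasCompactSupport fun x => η x • S x := hηc.smul_right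
  have h1 := integral_add_compl₀ hF (integrable_divergence hc hcc)
  rw [integral_divergence_eq_zero hc hcc] at h1
  rw [← h1, add_assoc, ← integral_add]
  · simp_rw [divergence_smul hη hS]
  · exact ((hη.continuous.mul (continuous_divergence hS)).integrable_of_hasCompactSupport
      hηc.mul_right).integrableOn
  · refine (((hη.continuous_fderiv one_ne_zero).clm_apply
      hS.continuous).integrable_of_hasCompactSupport ?_).integrableOn
    refine (hηc.fderiv (𝕜 := ℝ)).mono fun x hx h0 => hx ?_
    simp [h0]

/-- Replacing a test field `T` by `(1 - η) T` on `F` fills `F` up by the cutoff `η`. -/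
lemma setIntegral_divergence_add_cutoff (hF : NullMeasurableSet F volume) (hη : ContDiff ℝ 1 η)
    (hηc : HasCompactSupport η) (hT : ContDiff ℝ 1 T) (hTc : HasCompactSupport T) :
    (∫ x in F, divergence T x) + (∫ x in Fᶜ, η x * divergence T x) =
      (∫ x in F, divergence (fun x => T x - η x • T x) x) -
        ∫ x in Fᶜ, fderiv ℝ η x (T x) := by
  have h1 := setIntegral_divergence_cutoff hF hη hηc hT
  have hc : ContDiff ℝ 1 fun x => η x • T x := hη.smul hT
  simp_rw [divergence_sub hT hc]
  rw [integral_sub (integrable_divergence hT hTc).integrableOn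
    (integrable_divergence hc hηc.smul_right).integrableOn]
  linarith

lemma tendsto_setIntegral_cutoff {B : Set (Space n)} (hB : MeasurableSet B)
    {η : ℕ → Space n → ℝ} (hη : ∀ k, ContDiff ℝ 1 (η k)) (hη1 : ∀ k x, 0 ≤ η k x ∧ η k x ≤ 1)
    (hlim1 : ∀ x ∈ B, ∀ᶠ k in atTop, η k x = 1) (hlim0 : ∀ x ∉ B, ∀ᶠ k in atTop, η k x = 0)
    (F : Set (Space n)) (hT : ContDiff ℝ 1 T) (hTc : HasCompactSupport T) :
    Tendsto (fun k => ∫ x in Fᶜ, η k x * divergence T x) atTop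
      (𝓝 (∫ x in B \ F, divergence T x)) := by
  have h1 : ∫ x in B \ F, divergence T x = ∫ x in Fᶜ, B.indicator (divergence T) x := by
    rw [integral_indicator hB, Measure.restrict_restrict hB, Set.sdiff_eq]
  rw [h1]
  refine tendsto_integral_of_dominated_convergence (fun x => ‖divergence T x‖)
    (fun k => ((hη k).continuous.mul (continuous_divergence hT)).aestronglyMeasurable)
    (integrable_divergence hT hTc).integrableOn.norm
    (fun k => Eventually.of_forall fun x => ?_) (Eventually.of_forall fun x => ?_)
  · rw [norm_mul, Real.norm_of_nonneg (hη1 k x).1]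
    exact mul_le_of_le_one_left (norm_nonneg _) (hη1 k x).2
  · by_cases hx : x ∈ B
    · rw [Set.indicator_of_mem hx]
      refine tendsto_const_nhds.congr' ?_
      filter_upwards [hlim1 x hx] with k hk
      rw [hk, one_mul]
    · rw [Set.indicator_of_notMem hx]
      refine tendsto_const_nhds.congr' ?_
      filter_upwards [hlim0 x hx] with k hk
      rw [hk, zero_mul]

lemma setIntegral_union_eq_add_diff (hF : NullMeasurableSet F volume) {B : Set (Space n)}
    (hB : MeasurableSet B) {f : Space n → ℝ} (hf : Integrable f volume) :
    ∫ x in F ∪ B, f x = (∫ x in F, f x) + ∫ x in B \ F, f x := by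
  rw [← Set.union_sdiff_self]
  exact setIntegral_union₀ Set.disjoint_sdiff_right.aedisjoint (hB.nullMeasurableSet.diff hF)
    hf.integrableOn hf.integrableOn

end cutoff

lemma measureReal_sdiff_of_subset {A B : Set (Space n)} (hBA : B ⊆ A)
    (hB : NullMeasurableSet B volume) (hA : volume A ≠ ∞) :
    volume.real (A \ B) = volume.real A - volume.real B := by
  have hBfin : volume B ≠ ∞ := ((measure_mono hBA).trans_lt hA.lt_top).ne
  rw [measureReal_def, measure_sdiff hBA hB hBfin,
    ENNReal.toReal_sub_of_le (measure_mono hBA) hA]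
  rfl

lemma hasCompactSupport_fun_sub {T S : Space n → Space n} (hT : HasCompactSupport T)
    (hS : HasCompactSupport S) : HasCompactSupport fun x => T x - S x := by
  have h := hT.add hS.neg
  rwa [← sub_eq_add_neg] at h

/-- Test fields cut off by radial functions `η_k` increasing to the indicator of a ball pass to the
limit. -/
lemma tendsto_setIntegral_radial_cutoff {y : Space n} {s : ℝ} {t : ℕ → ℝ}
    (ht : Tendsto t atTop (𝓝 s)) {η : ℕ → Space n → ℝ}
    (hη : ∀ k, ContDiff ℝ 1 (η k)) (hη1 : ∀ k x, 0 ≤ η k x ∧ η k x ≤ 1)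
    (hin : ∀ k x, ‖x - y‖ ≤ t k → η k x = 1) (hout : ∀ k x, s ≤ ‖x - y‖ → η k x = 0)
    (F : Set (Space n)) {T : Space n → Space n} (hT : ContDiff ℝ 1 T) (hTc : HasCompactSupport T) :
    Tendsto (fun k => ∫ x in Fᶜ, η k x * divergence T x) atTop
      (𝓝 (∫ x in Metric.ball y s \ F, divergence T x)) := by
  refine tendsto_setIntegral_cutoff measurableSet_ball hη hη1 (fun x hx => ?_) (fun x hx => ?_)
    F hT hTc
  · rw [mem_ball_iff_norm] at hx
    filter_upwards [ht.eventually_const_lt hx] with k hk using hin k x hk.le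
  · rw [mem_ball_iff_norm, not_lt] at hx
    exact Eventually.of_forall fun k => hout k x hx

lemma tendsto_mul_one_sub_inv (s : ℝ) :
    Tendsto (fun k : ℕ => s * (1 - 1 / ((k : ℝ) + 2))) atTop (𝓝 s) := by
  have h : Tendsto (fun k : ℕ => 1 / ((k : ℝ) + 2)) atTop (𝓝 0) := by
    have := (tendsto_const_div_atTop_nhds_zero_nat (1 : ℝ)).comp (tendsto_add_atTop_nat 2)
    refine this.congr fun k => ?_
    simp
  simpa using (tendsto_const_nhds (x := (1 : ℝ)).sub h).const_mul s

lemma mul_one_sub_inv_mem_Ioo {s : ℝ} (hs : 0 < s) (k : ℕ) :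
    0 < s * (1 - 1 / ((k : ℝ) + 2)) ∧ s * (1 - 1 / ((k : ℝ) + 2)) < s := by
  have h2 : 1 / ((k : ℝ) + 2) < 1 := by
    rw [div_lt_one (by positivity)]
    linarith [(Nat.cast_nonneg k : (0 : ℝ) ≤ k)]
  have h3 : 0 < 1 / ((k : ℝ) + 2) := by positivity
  constructor
  · exact mul_pos hs (sub_pos.2 h2)
  · nlinarith

/-- Filling up a ball of radius `s` costs a perimeter that is linear in the added volume. The field
`(x - y) / s` calibrates the ball: its normal component is `1` on the sphere, and its divergence is
`n / s`. -/
theorem perimeter_union_ball_le {F : Set (Space n)} (hF : NullMeasurableSet F volume)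
    (y : Space n) {s : ℝ} (hs : 0 < s) :
    perimeter (F ∪ Metric.ball y s) ≤
      perimeter F + ENNReal.ofReal (n / s) * volume (Metric.ball y s \ F) := by
  by_cases hP : perimeter F = ∞
  · simp [hP]
  obtain ⟨M, -, hcut⟩ := exists_radial_cutoff n
  set p := (perimeter F).toReal with hp
  have hvfin : volume (Metric.ball y s \ F) ≠ ∞ :=
    ((measure_mono Set.sdiff_subset).trans_lt measure_ball_lt_top).ne
  set v := volume.real (Metric.ball y s \ F) with hv
  have hv0 : 0 ≤ v := measureReal_nonneg
  refine perimeter_le_of_forall fun T hT hTc hT1 => ?_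
  suffices h : ∫ x in F ∪ Metric.ball y s, divergence T x ≤ p + n / s * v by
    refine (ENNReal.ofReal_le_ofReal h).trans ?_
    rw [ENNReal.ofReal_add (by positivity) (by positivity), ENNReal.ofReal_mul (by positivity), hp,
      ENNReal.ofReal_toReal hP, hv, measureReal_def, ENNReal.ofReal_toReal hvfin]
  rw [setIntegral_union_eq_add_diff hF measurableSet_ball (integrable_divergence hT hTc)]
  have htlim := tendsto_mul_one_sub_inv s
  have htm := mul_one_sub_inv_mem_Ioo hs
  set t : ℕ → ℝ := fun k => s * (1 - 1 / ((k : ℝ) + 2)) with ht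
  choose η κ hη hηc hη1 hin hout hκ0 hκ hκM hκs using fun k => hcut y (t k) s (htm k).1 (htm k).2
  have hbound : Tendsto (fun k => s / t k * p + n / t k * v) atTop (𝓝 (p + n / s * v)) := by
    have := (((tendsto_const_nhds (x := s)).div htlim hs.ne').mul_const p).add
      (((tendsto_const_nhds (x := (n : ℝ))).div htlim hs.ne').mul_const v)
    rwa [div_self hs.ne', one_mul] at this
  refine le_of_tendsto_of_tendsto' ((tendsto_setIntegral_radial_cutoff htlim hη hη1 hin hout F hT
    hTc).const_add (∫ x in F, divergence T x)) hbound fun k => ?_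
  have ht0 := (htm k).1
  have hts := (htm k).2
  set X : Space n → Space n := fun x => (t k)⁻¹ • (x - y) with hX
  have hXc : ContDiff ℝ 1 X := contDiff_const.fun_smul (contDiff_id.sub contDiff_const)
  have hdX : ∀ x, divergence X x = n * (t k)⁻¹ := divergence_smul_sub _ y
  have hηX : ContDiff ℝ 1 fun x => η k x • X x := (hη k).smul hXc
  have hηT : ContDiff ℝ 1 fun x => η k x • T x := (hη k).smul hT
  have hTηT : ContDiff ℝ 1 fun x => T x - η k x • T x := hT.sub hηT
  have hTηTc : HasCompactSupport fun x => T x - η k x • T x :=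
    hasCompactSupport_fun_sub hTc (hηc k).smul_right
  have h1 := setIntegral_divergence_add_cutoff hF (hη k) (hηc k) hT hTc
  have h2 := setIntegral_divergence_cutoff hF (hη k) (hηc k) hXc
  -- Test `F` with `T` away from the ball and with the calibrating field `X` in it.
  have h3 := setIntegral_divergence_le hP (T := fun x => (T x - η k x • T x) + η k x • X x)
    (hTηT.add hηX) (hTηTc.add (hηc k).smul_right) (M := s / t k) (by positivity) (fun x => by
      have h01 := hη1 k x
      have hXn : η k x * ‖X x‖ ≤ η k x * (s / t k) := by
        rcases lt_or_ge ‖x - y‖ s with hx | hx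
        · refine mul_le_mul_of_nonneg_left ?_ h01.1
          rw [hX, norm_smul, Real.norm_of_nonneg (by positivity), div_eq_inv_mul]
          gcongr
        · rw [hout k x hx]; simp
      have hst : 1 ≤ s / t k := (one_le_div ht0).2 hts.le
      calc ‖(T x - η k x • T x) + η k x • X x‖ = ‖(1 - η k x) • T x + η k x • X x‖ := by
            rw [sub_smul, one_smul]
        _ ≤ (1 - η k x) * ‖T x‖ + η k x * ‖X x‖ := by
            refine (norm_add_le _ _).trans ?_
            rw [norm_smul, norm_smul, Real.norm_of_nonneg h01.1,
              Real.norm_of_nonneg (sub_nonneg.2 h01.2)]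
        _ ≤ (1 - η k x) * (s / t k) + η k x * (s / t k) := by
            refine add_le_add (mul_le_mul_of_nonneg_left ((hT1 x).trans hst)
              (sub_nonneg.2 h01.2)) hXn
        _ = s / t k := by ring)
  simp_rw [divergence_add hTηT hηX] at h3
  rw [integral_add (integrable_divergence hTηT hTηTc).integrableOn
    (integrable_divergence hηX (hηc k).smul_right).integrableOn] at h3
  -- The normal component of `X` dominates that of `T` where `∇η ≠ 0`.
  have hDi : ∀ S : Space n → Space n, ContDiff ℝ 1 S →
      Integrable (fun x => fderiv ℝ (η k) x (S x)) volume := fun S hS => by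
    refine (((hη k).continuous_fderiv one_ne_zero).clm_apply
      hS.continuous).integrable_of_hasCompactSupport ?_
    refine ((hηc k).fderiv (𝕜 := ℝ)).mono fun x hx h0 => hx ?_
    simp [h0]
  have h4 : ∫ x in Fᶜ, fderiv ℝ (η k) x (X x) ≤ ∫ x in Fᶜ, fderiv ℝ (η k) x (T x) := by
    refine integral_mono (hDi X hXc).integrableOn (hDi T hT).integrableOn fun x => ?_
    simp only [hκ]
    by_cases hx : κ k x = 0
    · simp [hx]
    have hxt := (hκs k x hx).1
    refine neg_le_neg (mul_le_mul_of_nonneg_left ?_ (hκ0 k x))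
    calc inner ℝ (x - y) (T x) ≤ ‖x - y‖ * ‖T x‖ := real_inner_le_norm _ _
      _ ≤ ‖x - y‖ * 1 := by gcongr; exact hT1 x
      _ ≤ ‖x - y‖ * ((t k)⁻¹ * ‖x - y‖) := by
          gcongr
          rw [inv_mul_eq_div, one_le_div ht0]
          exact hxt.le
      _ = inner ℝ (x - y) (X x) := by
          rw [hX, inner_smul_right, real_inner_self_eq_norm_sq]; ring
  have h5 : ∫ x in Fᶜ, η k x * divergence X x ≤ n / t k * v := by
    simp_rw [hdX]
    rw [integral_mul_const, mul_comm, ← div_eq_mul_inv]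
    refine mul_le_mul_of_nonneg_left ?_ (by positivity)
    calc ∫ x in Fᶜ, η k x ≤ ∫ x in Fᶜ, (Metric.ball y s).indicator (fun _ => (1 : ℝ)) x := by
          refine integral_mono
            ((hη k).continuous.integrable_of_hasCompactSupport (hηc k)).integrableOn
            ((integrable_indicator_iff measurableSet_ball).2 (integrableOn_const
              measure_ball_lt_top.ne)).integrableOn fun x => ?_
          by_cases hx : x ∈ Metric.ball y s
          · rw [Set.indicator_of_mem hx]; exact (hη1 k x).2
          · rw [Set.indicator_of_notMem hx]
            rw [mem_ball_iff_norm, not_lt] at hx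
            exact (hout k x hx).le
      _ = v := by
          rw [integral_indicator measurableSet_ball, Measure.restrict_restrict measurableSet_ball,
            ← Set.sdiff_eq]
          simp [hv]
  linarith

/-- Cutting along almost optimal spheres. For a suitable radius `t` between `a` and `b`, adding the
ball `B_t(y)` to `F` and, separately, extracting the part of `B_t(y)` outside `F` creates at most
the perimeter of `F` and twice the part of the sphere outside `F`; the latter is bounded by the mean
growth of `|B_r(y) ∖ F|`. -/
theorem exists_perimeter_union_add_perimeter_diff_le (n : ℕ) : ∃ M : ℝ, 0 < M ∧
    ∀ F : Set (Space n), NullMeasurableSet F volume → perimeter F ≠ ∞ →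
      ∀ (y : Space n) (a b : ℝ), 0 < a → a < b → ∃ t, a ≤ t ∧ t ≤ b ∧
        perimeter (F ∪ Metric.ball y t) + perimeter (Metric.ball y t \ F) ≤
          ENNReal.ofReal ((perimeter F).toReal + M *
            ((volume.real (Metric.ball y b \ F) - volume.real (Metric.ball y a \ F)) /
              (b - a))) := by
  obtain ⟨M, hM0, hcut⟩ := exists_radial_cutoff n
  refine ⟨2 * M, by positivity, fun F hF hP y a b ha hab => ?_⟩
  set p := (perimeter F).toReal with hp
  set m : ℝ → ℝ := fun r => volume.real (Metric.ball y r \ F) with hm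
  have hfin : ∀ r, volume (Metric.ball y r \ F) ≠ ∞ := fun r =>
    ((measure_mono Set.sdiff_subset).trans_lt measure_ball_lt_top).ne
  have hmono : Monotone m := fun r r' hr =>
    measureReal_mono (Set.sdiff_subset_sdiff_left (Metric.ball_subset_ball hr)) (hfin r')
  -- A monotone function has, somewhere, a derivative not exceeding its mean slope.
  obtain ⟨t, hta, htb, hdiff, hder⟩ : ∃ t, a ≤ t ∧ t ≤ b ∧ DifferentiableAt ℝ m t ∧
      deriv m t ≤ (m b - m a) / (b - a) := by
    have hN : (volume.restrict (Set.Ioc a b))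
        ({x | ¬ DifferentiableAt ℝ m x} ∪ (Set.Ioc a b)ᶜ) = 0 := by
      refine measure_union_null ?_ ?_
      · exact measure_mono_null (fun _ h => h)
          (ae_restrict_of_ae (μ := volume) hmono.ae_differentiableAt)
      · rw [Measure.restrict_apply measurableSet_Ioc.compl]; simp
    have hint := (hmono.monotoneOn (Set.uIcc a b)).intervalIntegrable_deriv
    have hfi : IsFiniteMeasure (volume.restrict (Set.Ioc a b)) := ⟨by simp⟩
    obtain ⟨t, htN, htle⟩ := exists_notMem_null_le_average (μ := volume.restrict (Set.Ioc a b))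
      (by simp [Measure.restrict_eq_zero, hab]) hint.1 hN
    simp only [Set.mem_union, Set.mem_ofPred_eq, Set.mem_compl_iff, not_or, not_not] at htN
    refine ⟨t, htN.2.1.le, htN.2.2, htN.1, htle.trans ?_⟩
    have h1 := (hmono.monotoneOn (Set.uIcc a b)).intervalIntegral_deriv_mem_uIcc
    rw [Set.uIcc_of_le (sub_nonneg.2 (hmono hab.le)), intervalIntegral.integral_of_le hab.le] at h1
    rw [setAverage_eq, measureReal_def, Real.volume_Ioc, ENNReal.toReal_ofReal (by linarith),
      smul_eq_mul, ← div_eq_inv_mul]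
    exact div_le_div_of_nonneg_right h1.2 (by linarith)
  refine ⟨t, hta, htb, ?_⟩
  have ht0 : 0 < t := ha.trans_le hta
  refine (perimeter_add_perimeter_le (c := p + 2 * M * deriv m t)
    fun T S hT hTc hT1 hS hSc hS1 => ?_).trans (ENNReal.ofReal_le_ofReal (by gcongr))
  rw [setIntegral_union_eq_add_diff hF measurableSet_ball (integrable_divergence hT hTc)]
  have hτlim := tendsto_mul_one_sub_inv t
  have hτm := mul_one_sub_inv_mem_Ioo ht0
  set τ : ℕ → ℝ := fun k => t * (1 - 1 / ((k : ℝ) + 2)) with hτ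
  choose η κ hη hηc hη1 hin hout hκ0 hκ hκM hκs using fun k => hcut y (τ k) t (hτm k).1 (hτm k).2
  have hslope : Tendsto (fun k => slope m t (τ k)) atTop (𝓝 (deriv m t)) :=
    hdiff.hasDerivAt.tendsto_slope.comp (tendsto_nhdsWithin_iff.2
      ⟨hτlim, Eventually.of_forall fun k => (hτm k).2.ne⟩)
  refine le_of_tendsto_of_tendsto'
    (((tendsto_setIntegral_radial_cutoff hτlim hη hη1 hin hout F hT hTc).const_add
      (∫ x in F, divergence T x)).add
      (tendsto_setIntegral_radial_cutoff hτlim hη hη1 hin hout F hS hSc))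
    ((hslope.const_mul (2 * M)).const_add p) fun k => ?_
  have hτ0 := (hτm k).1
  have hτt := (hτm k).2
  have hηS : ContDiff ℝ 1 fun x => η k x • S x := (hη k).smul hS
  have hηT : ContDiff ℝ 1 fun x => η k x • T x := (hη k).smul hT
  have hTηT : ContDiff ℝ 1 fun x => T x - η k x • T x := hT.sub hηT
  have hTηTc : HasCompactSupport fun x => T x - η k x • T x :=
    hasCompactSupport_fun_sub hTc (hηc k).smul_right
  have h1 := setIntegral_divergence_add_cutoff hF (hη k) (hηc k) hT hTc
  have h2 := setIntegral_divergence_cutoff hF (hη k) (hηc k) hS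
  -- Test `F` with `T` away from the ball and with `-S` in it, since `S` tests the complement of `F`.
  have h3 := setIntegral_divergence_le hP (T := fun x => (T x - η k x • T x) - η k x • S x)
    (hTηT.sub hηS) (hasCompactSupport_fun_sub hTηTc (hηc k).smul_right)
    one_pos (fun x => by
      have h01 := hη1 k x
      calc ‖(T x - η k x • T x) - η k x • S x‖ = ‖(1 - η k x) • T x - η k x • S x‖ := by
            rw [sub_smul, one_smul]
        _ ≤ (1 - η k x) * ‖T x‖ + η k x * ‖S x‖ := by
            refine (norm_sub_le _ _).trans ?_
            rw [norm_smul, norm_smul, Real.norm_of_nonneg h01.1,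
              Real.norm_of_nonneg (sub_nonneg.2 h01.2)]
        _ ≤ (1 - η k x) * 1 + η k x * 1 :=
            add_le_add (mul_le_mul_of_nonneg_left (hT1 x) (sub_nonneg.2 h01.2))
              (mul_le_mul_of_nonneg_left (hS1 x) h01.1)
        _ = 1 := by ring)
  simp_rw [divergence_sub hTηT hηS] at h3
  rw [integral_sub (integrable_divergence hTηT hTηTc).integrableOn
    (integrable_divergence hηS (hηc k).smul_right).integrableOn] at h3
  have hshell : volume.real ((Metric.ball y t \ Metric.ball y (τ k)) ∩ Fᶜ) = m t - m (τ k) := by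
    have hsub : Metric.ball y (τ k) \ F ⊆ Metric.ball y t \ F :=
      Set.sdiff_subset_sdiff_left (Metric.ball_subset_ball hτt.le)
    have hd := measureReal_sdiff_of_subset hsub
      (measurableSet_ball.nullMeasurableSet.diff hF) (hfin t)
    refine Eq.trans ?_ hd
    congr 1
    ext x
    simp only [Set.mem_inter_iff, Set.mem_sdiff, Set.mem_compl_iff]
    tauto
  have h4 : ∀ V : Space n → Space n, ContDiff ℝ 1 V → (∀ x, ‖V x‖ ≤ 1) →
      -∫ x in Fᶜ, fderiv ℝ (η k) x (V x) ≤ M / (t - τ k) * (m t - m (τ k)) := fun V hV hV1 => by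
    have hms : MeasurableSet (Metric.ball y t \ Metric.ball y (τ k)) :=
      measurableSet_ball.diff measurableSet_ball
    have hi : Integrable (fun x => fderiv ℝ (η k) x (V x)) volume := by
      refine (((hη k).continuous_fderiv one_ne_zero).clm_apply
        hV.continuous).integrable_of_hasCompactSupport ?_
      refine ((hηc k).fderiv (𝕜 := ℝ)).mono fun x hx h0 => hx ?_
      simp [h0]
    rw [← integral_neg]
    calc ∫ x in Fᶜ, -fderiv ℝ (η k) x (V x)
        ≤ ∫ x in Fᶜ, (Metric.ball y t \ Metric.ball y (τ k)).indicator
            (fun _ => M / (t - τ k)) x := by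
          refine integral_mono hi.neg.integrableOn ((integrable_indicator_iff hms).2
            (integrableOn_const ((measure_mono Set.sdiff_subset).trans_lt
              measure_ball_lt_top).ne)).integrableOn fun x => ?_
          simp only [hκ, neg_neg]
          have hpos : 0 ≤ M / (t - τ k) := div_nonneg hM0.le (sub_nonneg.2 hτt.le)
          by_cases hx : κ k x = 0
          · rw [hx, zero_mul]
            exact Set.indicator_nonneg (fun _ _ => hpos) x
          have hxs := hκs k x hx
          have hxm : x ∈ Metric.ball y t \ Metric.ball y (τ k) :=
            ⟨mem_ball_iff_norm.2 hxs.2, fun h => (mem_ball_iff_norm.1 h).not_ge hxs.1.le⟩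
          rw [Set.indicator_of_mem hxm]
          calc κ k x * inner ℝ (x - y) (V x) ≤ κ k x * (‖x - y‖ * 1) := by
                refine mul_le_mul_of_nonneg_left ((real_inner_le_norm _ _).trans ?_) (hκ0 k x)
                exact mul_le_mul_of_nonneg_left (hV1 x) (norm_nonneg _)
            _ ≤ _ := by rw [mul_one]; exact hκM k x
      _ = _ := by
          rw [integral_indicator hms, Measure.restrict_restrict hms, setIntegral_const, hshell,
            smul_eq_mul, mul_comm]
  have hT4 := h4 T hT hT1
  have hS4 := h4 S hS hS1
  have h5 : slope m t (τ k) = (m t - m (τ k)) / (t - τ k) := by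
    rw [slope_comm, slope_def_field]
  have h6 : M / (t - τ k) * (m t - m (τ k)) = M * slope m t (τ k) := by rw [h5]; ring
  rw [h6] at hT4 hS4
  linarith

/-! ### Density of the complement of an outward almost minimizer -/

/-- If adding balls to `E` saves at most a perimeter proportional to the added volume, and `E`
almost fills a ball, then it fills the concentric ball of half the radius. This is De Giorgi's
iteration for `m(t) = |B_t(y) ∖ E|`: the isoperimetric inequality applied to `B_t(y) ∖ E` gives
`m(a)^{n-1} ≤ C (m(b) / (b - a))^n` for `a < b`, and the radii `r (1/2 + 2^{-k-1})` are used. -/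
theorem exists_density_const (hn : 2 ≤ n) {C₁ : ℝ} (hC₁ : 0 ≤ C₁) : ∃ ε : ℝ, 0 < ε ∧
    ∀ E : Set (Space n), NullMeasurableSet E volume → perimeter E ≠ ∞ →
      ∀ (y : Space n) (r : ℝ), 0 < r → r ≤ 1 →
        (∀ t, 0 < t → t ≤ r → perimeter E ≤ perimeter (E ∪ Metric.ball y t) +
          ENNReal.ofReal (C₁ * volume.real (Metric.ball y t \ E))) →
        volume.real (Metric.ball y r \ E) ≤ ε * r ^ n →
        volume (Metric.ball y (r / 2) \ E) = 0 := by
  obtain ⟨M, hM0, hcut⟩ := exists_perimeter_union_add_perimeter_diff_le n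
  set w := volume.real (Metric.ball (0 : Space n) 1) with hw
  have hw0 : 0 < w := measureReal_unitBall_pos
  have hD : 0 < M + C₁ := by positivity
  set D := M + C₁ with hDdef
  set q : ℝ := (1 / 2) ^ n with hq
  have hq0 : 0 < q := by positivity
  -- The threshold for which the bound `m(r_k) ≤ ε rⁿ q^k` reproduces itself.
  set ε : ℝ := w * q ^ (n - 1) / (2 ^ (n + 1) * D ^ n * 4 ^ n) with hε
  have hε0 : 0 < ε := by positivity
  refine ⟨ε, hε0, fun E hE hP y r hr hr1 hmin hsmall => ?_⟩
  set m : ℝ → ℝ := fun t => volume.real (Metric.ball y t \ E) with hm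
  have hfin : ∀ t, volume (Metric.ball y t \ E) ≠ ∞ := fun t =>
    ((measure_mono Set.sdiff_subset).trans_lt measure_ball_lt_top).ne
  have hmono : Monotone m := fun t t' ht =>
    measureReal_mono (Set.sdiff_subset_sdiff_left (Metric.ball_subset_ball ht)) (hfin t')
  have hm0 : ∀ t, 0 ≤ m t := fun t => measureReal_nonneg
  have hstep : ∀ a b, 0 < a → a < b → b ≤ r →
      w * m a ^ (n - 1) ≤ 2 ^ (n + 1) * (D * m b / (b - a)) ^ n := by
    intro a b ha hab hbr
    have hba : 0 < b - a := sub_pos.2 hab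
    obtain ⟨t, hat, htb, ht⟩ := hcut E hE hP y a b ha hab
    have h1 := hmin t (ha.trans_le hat) (htb.trans hbr)
    have hPd : perimeter (Metric.ball y t \ E) ≠ ∞ :=
      ((le_add_left le_rfl).trans_lt (ht.trans_lt ENNReal.ofReal_lt_top)).ne
    have hPu : perimeter (E ∪ Metric.ball y t) ≠ ∞ :=
      ((le_add_right le_rfl).trans_lt (ht.trans_lt ENNReal.ofReal_lt_top)).ne
    have hmab : 0 ≤ (m b - m a) / (b - a) := div_nonneg (sub_nonneg.2 (hmono hab.le)) hba.le
    have h1' := ENNReal.toReal_mono (by simp [hPu]) h1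
    have ht' := ENNReal.toReal_mono ENNReal.ofReal_ne_top ht
    rw [ENNReal.toReal_add hPu ENNReal.ofReal_ne_top,
      ENNReal.toReal_ofReal (mul_nonneg hC₁ measureReal_nonneg)] at h1'
    rw [ENNReal.toReal_add hPu hPd, ENNReal.toReal_ofReal
      (add_nonneg ENNReal.toReal_nonneg (mul_nonneg hM0.le hmab))] at ht'
    have hper : (perimeter (Metric.ball y t \ E)).toReal ≤ D * m b / (b - a) := by
      have h2 : (m b - m a) / (b - a) ≤ m b / (b - a) := by
        gcongr
        linarith [hm0 a]
      have h3 : m t ≤ m b / (b - a) := by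
        rw [le_div_iff₀ hba]
        calc m t * (b - a) ≤ m b * 1 := by
              gcongr
              · exact hmono htb
              · linarith
          _ = m b := mul_one _
      have h4 : M * ((m b - m a) / (b - a)) ≤ M * (m b / (b - a)) := by gcongr
      have h5 : C₁ * m t ≤ C₁ * (m b / (b - a)) := by gcongr
      have h6 : D * m b / (b - a) = M * (m b / (b - a)) + C₁ * (m b / (b - a)) := by
        rw [hDdef]; ring
      linarith
    calc w * m a ^ (n - 1) ≤ w * m t ^ (n - 1) := by
          gcongr
          exact hmono hat
      _ ≤ 2 ^ (n + 1) * (perimeter (Metric.ball y t \ E)).toReal ^ n :=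
          isoperimetric hn (measurableSet_ball.nullMeasurableSet.diff hE) (hfin t) hPd
      _ ≤ _ := by gcongr
  -- The radii decrease from `r` to `r / 2`.
  let ρ : ℕ → ℝ := fun k => r * (1 / 2 + (1 / 2) ^ (k + 1))
  have hiter : ∀ k, m (ρ k) ≤ ε * r ^ n * q ^ k := by
    intro k
    induction k with
    | zero =>
      have : ρ 0 = r := by simp [ρ]; ring
      rw [this, pow_zero, mul_one]
      exact hsmall
    | succ k ih =>
      have hρ : ρ k - ρ (k + 1) = r * (1 / 2) ^ k / 4 := by simp only [ρ]; ring
      have hpk : (1 / 2 : ℝ) ^ (k + 1) ≤ 1 / 2 := by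
        rw [pow_succ]
        exact mul_le_of_le_one_left (by norm_num) (pow_le_one₀ (by norm_num) (by norm_num))
      have h1 := hstep (ρ (k + 1)) (ρ k) (by positivity)
        (by rw [← sub_pos, hρ]; positivity)
        (by
          calc ρ k ≤ r * (1 / 2 + 1 / 2) := by simp only [ρ]; gcongr
            _ = r := by ring)
      rw [hρ] at h1
      obtain ⟨N, rfl⟩ : ∃ N, n = N + 1 := ⟨n - 1, by omega⟩
      rw [Nat.add_sub_cancel] at h1 hε
      have hN : N ≠ 0 := by omega
      refine (pow_le_pow_iff_left₀ (hm0 _) (by positivity) hN).1 ?_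
      refine le_of_mul_le_mul_left ?_ hw0
      have hq2 : ((1 / 2 : ℝ) ^ k) ^ (N + 1) = q ^ k := by
        rw [hq, ← pow_mul, ← pow_mul, mul_comm]
      calc w * m (ρ (k + 1)) ^ N
          ≤ 2 ^ (N + 1 + 1) * (D * m (ρ k) / (r * (1 / 2) ^ k / 4)) ^ (N + 1) := h1
        _ ≤ 2 ^ (N + 1 + 1) *
            (D * (ε * r ^ (N + 1) * q ^ k) / (r * (1 / 2) ^ k / 4)) ^ (N + 1) := by
            have := hm0 (ρ k)
            gcongr
        _ = (2 ^ (N + 1 + 1) * D ^ (N + 1) * 4 ^ (N + 1) * ε) * (ε * r ^ (N + 1) * q ^ k) ^ N := by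
            rw [div_pow, mul_pow D, div_pow (r * _) 4, mul_pow r, hq2,
              pow_succ (ε * r ^ (N + 1) * q ^ k) N]
            field_simp
        _ = (w * q ^ N) * (ε * r ^ (N + 1) * q ^ k) ^ N := by
            congr 1
            rw [hε]
            field_simp
        _ = w * (ε * r ^ (N + 1) * q ^ (k + 1)) ^ N := by
            rw [pow_succ q k, ← mul_assoc (ε * r ^ (N + 1)), mul_pow _ q N]
            ring
  have hlim : Tendsto (fun k : ℕ => ε * r ^ n * q ^ k) atTop (𝓝 (ε * r ^ n * 0)) :=
    (tendsto_pow_atTop_nhds_zero_of_lt_one hq0.le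
      (pow_lt_one₀ (by norm_num) (by norm_num) (by omega))).const_mul _
  rw [mul_zero] at hlim
  have hle : m (r / 2) ≤ 0 := ge_of_tendsto' hlim fun k => (hmono (by
    simp only [ρ]
    rw [div_eq_mul_one_div]
    gcongr
    linarith [pow_pos (one_half_pos (α := ℝ)) (k + 1)])).trans (hiter k)
  exact (measureReal_eq_zero_iff (hfin _)).1 (le_antisymm hle (hm0 _))

/-! ### Growing balls to a prescribed volume -/

/-- If `F` contains almost all of a ball inside `B_R`, a larger ball inside `B_R` adds any
prescribed volume up to that of `B_R ∖ F`. -/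
lemma exists_ball_diff_eq {F : Set (Space n)} {y : Space n} {s R δ : ℝ} (hs : 0 < s)
    (hys : ‖y‖ + s ≤ R) (h0 : volume (Metric.ball y s \ F) = 0) (hδ : 0 ≤ δ)
    (hδR : δ ≤ volume.real (Metric.ball 0 R \ F)) :
    ∃ (z : Space n) (t : ℝ), s ≤ t ∧ ‖z‖ + t ≤ R ∧ volume.real (Metric.ball z t \ F) = δ := by
  have hsR : s ≤ R := by linarith [norm_nonneg y]
  set c : ℝ → Space n := fun τ => (1 - τ) • y with hc
  set ρ : ℝ → ℝ := fun τ => (1 - τ) * s + τ * R with hρ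
  set w := volume.real (Metric.ball (0 : Space n) 1) with hw
  have hρs : ∀ τ ∈ Set.Icc (0 : ℝ) 1, s ≤ ρ τ := fun τ hτ => by
    simp only [hρ]; nlinarith [hτ.1]
  set f : ℝ → ℝ := fun τ => volume.real (Metric.ball (c τ) (ρ τ) \ F) with hf
  have hsub : ∀ τ τ', τ ≤ τ' → Metric.ball (c τ) (ρ τ) ⊆ Metric.ball (c τ') (ρ τ') := by
    intro τ τ' h
    refine Metric.ball_subset_ball' ?_
    rw [dist_eq_norm]
    have : c τ - c τ' = (τ' - τ) • y := by simp only [hc, ← sub_smul]; congr 1; ring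
    rw [this, norm_smul, Real.norm_of_nonneg (sub_nonneg.2 h)]
    simp only [hρ]
    nlinarith
  have hfin : ∀ τ, volume (Metric.ball (c τ) (ρ τ)) ≠ ∞ := fun τ => measure_ball_lt_top.ne
  have hfinF : ∀ τ, volume (Metric.ball (c τ) (ρ τ) \ F) ≠ ∞ := fun τ =>
    ((measure_mono Set.sdiff_subset).trans_lt measure_ball_lt_top).ne
  have hvol : ∀ τ ∈ Set.Icc (0 : ℝ) 1,
      volume.real (Metric.ball (c τ) (ρ τ)) = ρ τ ^ n * w := fun τ hτ =>
    measureReal_ball _ (hs.trans_le (hρs τ hτ))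
  have hmono : ∀ τ ∈ Set.Icc (0 : ℝ) 1, ∀ τ' ∈ Set.Icc (0 : ℝ) 1, τ ≤ τ' →
      f τ ≤ f τ' ∧ f τ' - f τ ≤ ρ τ' ^ n * w - ρ τ ^ n * w := by
    intro τ hτ τ' hτ' h
    refine ⟨measureReal_mono (Set.sdiff_subset_sdiff_left (hsub τ τ' h)) (hfinF τ'), ?_⟩
    rw [← hvol τ hτ, ← hvol τ' hτ', ← measureReal_sdiff_of_subset (hsub τ τ' h)
      measurableSet_ball.nullMeasurableSet (hfin τ'), sub_le_iff_le_add]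
    refine (measureReal_mono ?_ (measure_union_lt_top
      ((measure_mono Set.sdiff_subset).trans_lt (hfin τ').lt_top) (hfinF τ).lt_top).ne).trans
      (measureReal_union_le _ _)
    intro x hx
    by_cases hxτ : x ∈ Metric.ball (c τ) (ρ τ)
    · exact Or.inr ⟨hxτ, hx.2⟩
    · exact Or.inl ⟨hx.1, hxτ⟩
  have habs : ∀ τ ∈ Set.Icc (0 : ℝ) 1, ∀ τ' ∈ Set.Icc (0 : ℝ) 1,
      |f τ' - f τ| ≤ |ρ τ' ^ n * w - ρ τ ^ n * w| := by
    intro τ hτ τ' hτ'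
    rcases le_total τ τ' with h | h
    · obtain ⟨h1, h2⟩ := hmono τ hτ τ' hτ' h
      rw [abs_of_nonneg (sub_nonneg.2 h1)]
      exact h2.trans (le_abs_self _)
    · obtain ⟨h1, h2⟩ := hmono τ' hτ' τ hτ h
      rw [abs_sub_comm, abs_of_nonneg (sub_nonneg.2 h1), abs_sub_comm]
      exact h2.trans (le_abs_self _)
  have hcont : ContinuousOn f (Set.Icc 0 1) := by
    intro τ hτ
    have hρc : Continuous fun τ => ρ τ ^ n * w := by fun_prop
    refine tendsto_iff_dist_tendsto_zero.2 (squeeze_zero' (g := fun τ' =>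
      |ρ τ' ^ n * w - ρ τ ^ n * w|) (Eventually.of_forall fun _ => dist_nonneg) ?_ ?_)
    · filter_upwards [self_mem_nhdsWithin] with τ' hτ'
      rw [Real.dist_eq]
      exact habs τ hτ τ' hτ'
    · have h1 : Tendsto (fun τ' => |ρ τ' ^ n * w - ρ τ ^ n * w|) (𝓝 τ)
          (𝓝 |ρ τ ^ n * w - ρ τ ^ n * w|) := (hρc.tendsto τ |>.sub tendsto_const_nhds).abs
      rw [sub_self, abs_zero] at h1
      exact h1.mono_left nhdsWithin_le_nhds
  have hf0 : f 0 = 0 := by simp [hf, hc, hρ, measureReal_def, h0]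
  have hf1 : f 1 = volume.real (Metric.ball 0 R \ F) := by simp [hf, hc, hρ]
  obtain ⟨τ, hτ, hτδ⟩ := intermediate_value_Icc zero_le_one hcont
    (show δ ∈ Set.Icc (f 0) (f 1) from ⟨hf0.le.trans hδ, hδR.trans hf1.ge⟩)
  refine ⟨c τ, ρ τ, hρs τ hτ, ?_, hτδ⟩
  rw [hc, norm_smul, Real.norm_of_nonneg (sub_nonneg.2 hτ.2)]
  simp only [hρ]
  nlinarith [hτ.1, hτ.2]

/-- A modification of `E` in a small ball leaves some smaller ball filled. -/
lemma exists_ball_diff_null_of_symmDiff (hn : 1 ≤ n) {E F : Set (Space n)} {y x₀ : Space n}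
    {s r : ℝ} (hs : 0 < s) (hr : r ≤ s / 4) (h0 : volume (Metric.ball y s \ E) = 0)
    (hEF : symmDiff E F ⊆ Metric.ball x₀ r) :
    ∃ z : Space n, ‖z‖ ≤ ‖y‖ + s / 2 ∧ volume (Metric.ball z (s / 4) \ F) = 0 := by
  -- Move the centre from `y` by `s / 2` in a direction pointing away from `x₀`.
  obtain ⟨e, he1, he⟩ : ∃ e : Space n, ‖e‖ = 1 ∧ 0 ≤ inner ℝ (y - x₀) e := by
    set e₀ : Space n := EuclideanSpace.single ⟨0, hn⟩ 1
    have h1 : ‖e₀‖ = 1 := by simp [e₀]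
    rcases le_total 0 (inner ℝ (y - x₀) e₀) with h | h
    · exact ⟨e₀, h1, h⟩
    · exact ⟨-e₀, by rwa [norm_neg], by rw [inner_neg_right]; linarith⟩
  have hse : ‖(s / 2) • e‖ = s / 2 := by
    rw [norm_smul, he1, mul_one, Real.norm_of_nonneg (by positivity)]
  have hfar : s / 2 ≤ ‖y + (s / 2) • e - x₀‖ := by
    refine le_of_sq_le_sq ?_ (norm_nonneg _)
    have : y + (s / 2) • e - x₀ = (y - x₀) + (s / 2) • e := by abel
    rw [this, norm_add_sq_real, hse, inner_smul_right]
    have : 0 ≤ s / 2 * inner ℝ (y - x₀) e := by positivity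
    nlinarith [sq_nonneg ‖y - x₀‖]
  refine ⟨y + (s / 2) • e, (norm_add_le _ _).trans (by rw [hse]), ?_⟩
  refine measure_mono_null (fun x hx => ?_) h0
  have hx1 := mem_ball_iff_norm.1 hx.1
  constructor
  · rw [mem_ball_iff_norm]
    calc ‖x - y‖ = ‖(x - (y + (s / 2) • e)) + (s / 2) • e‖ := by congr 1; abel
      _ ≤ ‖x - (y + (s / 2) • e)‖ + s / 2 := (norm_add_le _ _).trans_eq (by rw [hse])
      _ < s := by linarith
  · intro hxE
    have h1 := mem_ball_iff_norm.1 (hEF (Or.inl ⟨hxE, hx.2⟩))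
    have h2 : ‖y + (s / 2) • e - x₀‖ ≤ ‖x - (y + (s / 2) • e)‖ + ‖x - x₀‖ := by
      rw [norm_sub_rev x]
      calc _ = ‖(y + (s / 2) • e - x) + (x - x₀)‖ := by congr 1; abel
        _ ≤ _ := norm_add_le _ _
    linarith

/-! ### Minimizers -/

lemma perimeter_empty : perimeter (∅ : Set (Space n)) = 0 :=
  le_antisymm (perimeter_le_of_forall fun T _ _ _ => by simp) zero_le

lemma perimeter_unitBall_le :
    perimeter (Metric.ball (0 : Space n) 1) ≤
      ENNReal.ofReal (n * volume.real (Metric.ball (0 : Space n) 1)) := by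
  have := perimeter_union_ball_le (F := ∅) (nullMeasurableSet_empty) (0 : Space n) one_pos
  rwa [Set.empty_union, perimeter_empty, zero_add, div_one, Set.sdiff_empty,
    ← ENNReal.ofReal_toReal (measure_ball_lt_top (x := (0 : Space n)) (r := 1)).ne,
    ← ENNReal.ofReal_mul (Nat.cast_nonneg n)] at this

/-- The energy of the unit ball is bounded in terms of the dimension and the bound `A` on the
parameters. -/
lemma exists_energy_ball_le (hn : 3 ≤ n) (A : ℝ) : ∃ C₀ : ℝ, 0 < C₀ ∧
    ∀ β K Q : ℝ, ControlledBy A β K Q →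
      energy β K Q (Metric.ball (0 : Space n) 1) ≤ ENNReal.ofReal C₀ := by
  obtain ⟨C, hC⟩ := exists_chargeEnergy_ball_le hn
  set w := volume.real (Metric.ball (0 : Space n) 1) with hw
  have hw0 : 0 < w := measureReal_unitBall_pos
  refine ⟨n * w + A ^ 2 * (C ^ 2 + |A| * w⁻¹), by positivity, fun β K Q h => ?_⟩
  have hK := h.K_pos
  have hQ := h.Q_nonneg
  have hβ := h.one_le_beta
  have hK' : 0 < 1 / K := by positivity
  have hsum := h.sum_le
  have hA : 0 < A := by linarith
  rw [abs_of_pos hA, ENNReal.ofReal_add (by positivity) (by positivity),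
    ENNReal.ofReal_mul (by positivity : 0 ≤ A ^ 2), ENNReal.ofReal_add (by positivity)
      (by positivity), ENNReal.ofReal_mul hA.le]
  refine add_le_add perimeter_unitBall_le (mul_le_mul' (ENNReal.ofReal_le_ofReal ?_)
    ((hC β K hβ).trans ?_))
  · have : Q ≤ A := by linarith
    gcongr
  · gcongr
    linarith

section minimizer

variable {β K Q R : ℝ} {E F : Set (Space n)}

open scoped Pointwise

/-- A minimizer compared with sets of larger volume: these are shrunk to the volume of the unit
ball, which does not increase the perimeter and only increases the charge energy in proportion to
the excess volume. -/
lemma IsMinimizer.energy_le_of_volume_ge (hE : IsMinimizer β K Q R E) (hn : 3 ≤ n)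
    (hβ : 1 ≤ β) (hF : NullMeasurableSet F volume) (hFR : F ⊆ Metric.ball 0 R)
    (hvol : volume.real (Metric.ball (0 : Space n) 1) ≤ volume.real F) :
    energy β K Q E ≤ energy β K Q F +
      ENNReal.ofReal ((volume.real F - volume.real (Metric.ball (0 : Space n) 1)) /
        volume.real (Metric.ball (0 : Space n) 1)) *
        (ENNReal.ofReal (Q ^ 2) * chargeEnergy β K F) := by
  set w := volume.real (Metric.ball (0 : Space n) 1) with hw
  have hw0 : 0 < w := measureReal_unitBall_pos
  have hFfin : volume F ≠ ∞ := ((measure_mono hFR).trans_lt measure_ball_lt_top).ne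
  set v := volume.real F with hv
  have hv0 : 0 < v := hw0.trans_le hvol
  set c : ℝ := (w / v) ^ ((n : ℝ)⁻¹) with hc
  have hc0 : 0 < c := by positivity
  have hcn : c ^ n = w / v := Real.rpow_inv_natCast_pow (by positivity) (by omega)
  have hc1 : c ≤ 1 := Real.rpow_le_one (by positivity) ((div_le_one hv0).2 hvol) (by positivity)
  have hcomp : IsCompetitor R (c • F) := by
    refine ⟨nullMeasurableSet_smul hF hc0.ne', ?_, ?_⟩
    · rintro _ ⟨x, hx, rfl⟩
      have h1 := mem_ball_zero_iff.1 (hFR hx)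
      simp only [mem_ball_zero_iff, norm_smul, Real.norm_of_nonneg hc0.le]
      exact (mul_le_of_le_one_left (norm_nonneg _) hc1).trans_lt h1
    · rw [Measure.addHaar_smul, finrank_euclideanSpace, Fintype.card_fin,
        abs_of_pos (by positivity), hcn, ← ENNReal.ofReal_toReal hFfin,
        ← ENNReal.ofReal_toReal (measure_ball_lt_top (x := (0 : Space n)) (r := 1)).ne,
        ← ENNReal.ofReal_mul (by positivity)]
      congr 1
      change w / v * v = w
      field_simp
  refine (hE.energy_le _ hcomp).trans ?_
  have h1 := chargeEnergy_smul_le hn (K := K) hβ hF hc0 hc1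
  have h2 : (c ^ n)⁻¹ = 1 + (v - w) / w := by rw [hcn]; field_simp; ring
  rw [h2, ENNReal.ofReal_add zero_le_one (div_nonneg (sub_nonneg.2 hvol) hw0.le),
    ENNReal.ofReal_one, add_mul, one_mul] at h1
  calc energy β K Q (c • F) ≤ perimeter F + ENNReal.ofReal (Q ^ 2) * (chargeEnergy β K F +
        ENNReal.ofReal ((v - w) / w) * chargeEnergy β K F) :=
        add_le_add (perimeter_smul_le (by omega) hc0 hc1) (by gcongr)
    _ = _ := by rw [energy]; ring

lemma IsMinimizer.volume_real_eq (hE : IsMinimizer β K Q R E) :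
    volume.real E = volume.real (Metric.ball (0 : Space n) 1) := by
  rw [measureReal_def, hE.isCompetitor.volume_eq]
  rfl

lemma IsMinimizer.volume_ne_top (hE : IsMinimizer β K Q R E) : volume E ≠ ∞ := by
  rw [hE.isCompetitor.volume_eq]
  exact measure_ball_lt_top.ne

lemma IsMinimizer.energy_le_energy_ball (hE : IsMinimizer β K Q R E) (hR : 1 ≤ R) :
    energy β K Q E ≤ energy β K Q (Metric.ball (0 : Space n) 1) :=
  hE.energy_le _ ⟨measurableSet_ball.nullMeasurableSet, Metric.ball_subset_ball hR, rfl⟩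

lemma measureReal_union_ball_eq (hE : NullMeasurableSet E volume) (hEfin : volume E ≠ ∞)
    (y : Space n) (t : ℝ) :
    volume.real (E ∪ Metric.ball y t) = volume.real E + volume.real (Metric.ball y t \ E) := by
  have hBfin : volume (Metric.ball y t \ E) ≠ ∞ :=
    ((measure_mono Set.sdiff_subset).trans_lt measure_ball_lt_top).ne
  rw [← Set.union_sdiff_self, measureReal_def, measure_union₀
    (measurableSet_ball.nullMeasurableSet.diff hE) Set.disjoint_sdiff_right.aedisjoint,
    ENNReal.toReal_add hEfin hBfin]
  rfl

/-- Adding a ball to a minimizer saves at most a perimeter proportional to the added volume, since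
it does not increase the charge energy. -/
lemma IsMinimizer.perimeter_le_union_ball (hE : IsMinimizer β K Q R E) (hn : 3 ≤ n)
    (hβ : 1 ≤ β) {C₀ : ℝ} (hC₀ : energy β K Q E ≤ ENNReal.ofReal C₀) {y : Space n} {t : ℝ}
    (hy : Metric.ball y t ⊆ Metric.ball 0 R) :
    perimeter E ≤ perimeter (E ∪ Metric.ball y t) +
      ENNReal.ofReal (C₀ / volume.real (Metric.ball (0 : Space n) 1) *
        volume.real (Metric.ball y t \ E)) := by
  have hEm := hE.isCompetitor.measurable
  have hEfin := hE.volume_ne_top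
  set w := volume.real (Metric.ball (0 : Space n) 1) with hw
  have hw0 : 0 < w := measureReal_unitBall_pos
  set B := Metric.ball y t with hB
  have hBm : NullMeasurableSet B volume := measurableSet_ball.nullMeasurableSet
  set v := volume.real (B \ E) with hv
  have hvol : volume.real (E ∪ B) = w + v := by
    rw [measureReal_union_ball_eq hEm hEfin, hE.volume_real_eq]
  have hv0 : 0 ≤ v := measureReal_nonneg
  have h1 := hE.energy_le_of_volume_ge hn hβ (hEm.union hBm)
    (Set.union_subset hE.isCompetitor.subset_ball hy) (by rw [hvol]; linarith)
  rw [hvol, add_sub_cancel_left] at h1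
  set X := ENNReal.ofReal (Q ^ 2) * chargeEnergy β K E with hX
  have hXC : X ≤ ENNReal.ofReal C₀ := (le_add_left le_rfl).trans hC₀
  have hanti : ENNReal.ofReal (Q ^ 2) * chargeEnergy β K (E ∪ B) ≤ X :=
    mul_le_mul_right (chargeEnergy_anti hn hβ hEm (hEm.union hBm) Set.subset_union_left) _
  have h2 : perimeter E + X ≤
      (perimeter (E ∪ B) + ENNReal.ofReal (C₀ / w * v)) + X := by
    calc perimeter E + X ≤ (perimeter (E ∪ B) + X) + ENNReal.ofReal (v / w) * X := by
          refine h1.trans ?_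
          rw [energy]
          gcongr
      _ ≤ (perimeter (E ∪ B) + X) + ENNReal.ofReal (v / w) * ENNReal.ofReal C₀ := by gcongr
      _ = _ := by
          rw [← ENNReal.ofReal_mul (by positivity), show v / w * C₀ = C₀ / w * v by ring]
          ring
  exact (ENNReal.add_le_add_iff_right (hXC.trans_lt ENNReal.ofReal_lt_top).ne).1 h2

/-- A minimizer contains almost all of a ball whose radius depends only on the dimension and the
energy bound. A point around which `E` is dense at a small scale exists by the translation estimate,
and the density estimate for the complement fills a ball around it. -/
lemma exists_filled_ball (hn : 3 ≤ n) {C₀ : ℝ} (hC₀ : 0 < C₀) : ∃ s : ℝ, 0 < s ∧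
    ∀ (β K Q R : ℝ) (E : Set (Space n)), 1 ≤ β → 1 ≤ R → IsMinimizer β K Q R E →
      energy β K Q E ≤ ENNReal.ofReal C₀ →
      ∃ y : Space n, ‖y‖ + s ≤ R ∧ volume (Metric.ball y s \ E) = 0 := by
  set w := volume.real (Metric.ball (0 : Space n) 1) with hw
  have hw0 : 0 < w := measureReal_unitBall_pos
  obtain ⟨ε, hε, hdens⟩ := exists_density_const (n := n) (by omega) (C₁ := C₀ / w) (by positivity)
  -- `ε / 2ⁿ` is the density threshold at radius `r / 2`; the ball of radius `r / 4` used below to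
  -- show that `B_{r/2}(x)` lies in `B_R` has volume `w (r / 4)ⁿ`.
  set ε' : ℝ := min (ε / 2 ^ n) (w / 4 ^ n) with hε'
  have hε'0 : 0 < ε' := lt_min (by positivity) (by positivity)
  set r : ℝ := min 1 (ε' / (2 * C₀)) with hr
  have hr0 : 0 < r := lt_min one_pos (by positivity)
  have hr1 : r ≤ 1 := min_le_left _ _
  have hrC : r * C₀ < ε' := by
    have : r ≤ ε' / (2 * C₀) := min_le_right _ _
    rw [le_div_iff₀ (by positivity)] at this
    nlinarith [mul_pos hr0 hC₀]
  refine ⟨r / 2 / 2, by positivity, fun β K Q R E hβ hR hE hen => ?_⟩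
  have hEm := hE.isCompetitor.measurable
  have hP : perimeter E ≤ ENNReal.ofReal C₀ := (le_add_right le_rfl).trans hen
  have hPfin : perimeter E ≠ ∞ := (hP.trans_lt ENNReal.ofReal_lt_top).ne
  have hp : (perimeter E).toReal ≤ C₀ := ENNReal.toReal_le_of_le_ofReal hC₀.le hP
  obtain ⟨x, hxE, hx⟩ : ∃ x ∈ E, volume.real (Metric.ball x r \ E) < ε' * r ^ n := by
    by_contra! h
    have h1 := mul_measureReal_le_of_forall_ball_diff hEm hE.volume_ne_top hPfin hr0.le h
    rw [hE.volume_real_eq, measureReal_ball _ hr0, ← hw] at h1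
    have h2 : ε' * (r ^ n * w) ≤ r * (perimeter E).toReal * (r ^ n * w) := by linarith
    have h3 := le_of_mul_le_mul_right h2 (by positivity)
    have h4 : r * (perimeter E).toReal ≤ r * C₀ := by gcongr
    linarith
  have hfin : volume (Metric.ball x r \ E) ≠ ∞ :=
    ((measure_mono Set.sdiff_subset).trans_lt measure_ball_lt_top).ne
  -- If this failed, a ball of radius `r / 4` outside `B_R` would be contained in `B_r(x) ∖ E`.
  have hxR : ‖x‖ + r / 2 ≤ R := by
    by_contra! h
    have hx0 : 0 < ‖x‖ := by linarith
    set z : Space n := x + (3 * r / 4 / ‖x‖) • x with hz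
    have hzx : ‖(3 * r / 4 / ‖x‖) • x‖ = 3 * r / 4 := by
      rw [norm_smul, Real.norm_of_nonneg (by positivity)]
      field_simp
    have hzn : ‖z‖ = ‖x‖ + 3 * r / 4 := by
      have : z = (1 + 3 * r / 4 / ‖x‖) • x := by rw [hz, add_smul, one_smul]
      rw [this, norm_smul, Real.norm_of_nonneg (by positivity)]
      field_simp
    have hsub : Metric.ball z (r / 4) ⊆ Metric.ball x r \ E := by
      intro u hu
      have hu1 := mem_ball_iff_norm.1 hu
      constructor
      · rw [mem_ball_iff_norm]
        calc ‖u - x‖ = ‖(u - z) + (3 * r / 4 / ‖x‖) • x‖ := by rw [hz]; congr 1; abel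
          _ ≤ ‖u - z‖ + 3 * r / 4 := (norm_add_le _ _).trans_eq (by rw [hzx])
          _ < r := by linarith
      · intro huE
        have h1 := mem_ball_zero_iff.1 (hE.isCompetitor.subset_ball huE)
        have h2 : ‖z‖ ≤ ‖u - z‖ + ‖u‖ := by
          rw [norm_sub_rev]
          calc ‖z‖ = ‖(z - u) + u‖ := by congr 1; abel
            _ ≤ _ := norm_add_le _ _
        linarith
    have h3 := measureReal_mono hsub hfin
    rw [measureReal_ball _ (by positivity), ← hw, div_pow] at h3
    have h4 : ε' * r ^ n ≤ w / 4 ^ n * r ^ n := by gcongr; exact min_le_right _ _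
    have h5 : w / 4 ^ n * r ^ n = r ^ n / 4 ^ n * w := by ring
    linarith
  refine ⟨x, by linarith, hdens E hEm hPfin x (r / 2) (by positivity) (by linarith)
    (fun t _ ht => hE.perimeter_le_union_ball hn hβ hen ?_) ?_⟩
  · refine Metric.ball_subset_ball' ?_
    rw [dist_zero_right]
    linarith
  · calc volume.real (Metric.ball x (r / 2) \ E) ≤ volume.real (Metric.ball x r \ E) :=
          measureReal_mono (Set.sdiff_subset_sdiff_left (Metric.ball_subset_ball (by linarith)))
            hfin
      _ ≤ ε' * r ^ n := hx.le
      _ ≤ ε / 2 ^ n * r ^ n := by gcongr; exact min_le_left _ _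
      _ = ε * (r / 2) ^ n := by rw [div_pow]; ring

/-- A minimizer compared with a set `F` of smaller volume that contains almost all of a ball: the
missing volume is filled up by a larger ball. -/
lemma IsMinimizer.energy_le_of_volume_le (hE : IsMinimizer β K Q R E) (hn : 3 ≤ n)
    (hβ : 1 ≤ β) (hR : 1 ≤ R) (hF : NullMeasurableSet F volume) (hFR : F ⊆ Metric.ball 0 R)
    (hvol : volume.real F ≤ volume.real E) {y : Space n} {s : ℝ} (hs : 0 < s)
    (hys : ‖y‖ + s ≤ R) (h0 : volume (Metric.ball y s \ F) = 0) :
    energy β K Q E ≤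
      energy β K Q F + ENNReal.ofReal (n / s * (volume.real E - volume.real F)) := by
  have hFfin : volume F ≠ ∞ := ((measure_mono hFR).trans_lt measure_ball_lt_top).ne
  rw [hE.volume_real_eq] at hvol ⊢
  set w := volume.real (Metric.ball (0 : Space n) 1) with hw
  obtain ⟨z, t, hst, hzt, hδ⟩ := exists_ball_diff_eq (F := F)
    (δ := w - volume.real F) hs hys h0 (sub_nonneg.2 hvol) (by
      rw [measureReal_sdiff_of_subset hFR hF measure_ball_lt_top.ne]
      gcongr
      exact measureReal_mono (Metric.ball_subset_ball hR) measure_ball_lt_top.ne)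
  have ht : 0 < t := hs.trans_le hst
  set B := Metric.ball z t with hB
  have hBm : NullMeasurableSet B volume := measurableSet_ball.nullMeasurableSet
  have hBR : B ⊆ Metric.ball 0 R := Metric.ball_subset_ball' (by rw [dist_zero_right]; linarith)
  have hBfin : volume (B \ F) ≠ ∞ :=
    ((measure_mono Set.sdiff_subset).trans_lt measure_ball_lt_top).ne
  have hFB : F ∪ B ⊆ Metric.ball 0 R := Set.union_subset hFR hBR
  have hcomp : IsCompetitor R (F ∪ B) := by
    refine ⟨hF.union hBm, hFB, ?_⟩
    rw [← ENNReal.toReal_eq_toReal_iff' ((measure_mono hFB).trans_lt measure_ball_lt_top).ne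
      measure_ball_lt_top.ne]
    change volume.real (F ∪ B) = w
    rw [measureReal_union_ball_eq hF hFfin, hδ]
    ring
  have hper := perimeter_union_ball_le hF z ht
  have h1 : ENNReal.ofReal (n / t) * volume (B \ F) ≤
      ENNReal.ofReal (n / s * (w - volume.real F)) := by
    rw [← ENNReal.ofReal_toReal hBfin, ← ENNReal.ofReal_mul (by positivity)]
    change ENNReal.ofReal (n / t * volume.real (B \ F)) ≤ _
    rw [hδ]
    have := sub_nonneg.2 hvol
    gcongr
  calc energy β K Q E ≤ energy β K Q (F ∪ B) := hE.energy_le _ hcomp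
    _ ≤ (perimeter F + ENNReal.ofReal (n / s * (w - volume.real F))) +
        ENNReal.ofReal (Q ^ 2) * chargeEnergy β K F := by
        refine add_le_add (hper.trans (by gcongr)) ?_
        gcongr
        exact chargeEnergy_anti hn hβ hF (hF.union hBm) Set.subset_union_left
    _ = _ := by rw [energy]; ring

end minimizer

lemma measureReal_sub_le_symmDiff {E F : Set (Space n)} (hE : volume E ≠ ∞) (hF : volume F ≠ ∞) :
    volume.real E - volume.real F ≤ volume.real (symmDiff E F) := by
  have hfin : volume (symmDiff E F) ≠ ∞ :=
    ((measure_mono Set.symmDiff_subset_union).trans_lt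
      (measure_union_lt_top hE.lt_top hF.lt_top)).ne
  rw [sub_le_iff_le_add]
  refine (measureReal_mono (fun x hx => ?_) (measure_union_lt_top hfin.lt_top hF.lt_top).ne).trans
    (measureReal_union_le _ _)
  by_cases hxF : x ∈ F
  · exact Or.inr hxF
  · exact Or.inl (Or.inl ⟨hx, hxF⟩)

end ChargedDroplet

theorem propositiont2 (n : ℕ) (hn : 3 ≤ n) (A : ℝ) (hA : 0 < A) :
    ∃ Λ₁ r₁ : ℝ, 0 < Λ₁ ∧ 0 < r₁ ∧
      ∀ β K Q R : ℝ, ChargedDroplet.ControlledBy A β K Q → 1 ≤ R →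
        ∀ E : Set (ChargedDroplet.Space n), ChargedDroplet.IsMinimizer β K Q R E →
          ∀ F : Set (ChargedDroplet.Space n), NullMeasurableSet F volume →
            F ⊆ Metric.ball 0 R →
            ∀ (x₀ : ChargedDroplet.Space n) (r : ℝ), r ≤ r₁ →
              symmDiff E F ⊆ Metric.ball x₀ r →
              ChargedDroplet.energy β K Q E ≤
                ChargedDroplet.energy β K Q F + ENNReal.ofReal Λ₁ * volume (symmDiff E F) := by
  open ChargedDroplet in
  obtain ⟨C₀, hC₀, hball⟩ := exists_energy_ball_le hn A
  obtain ⟨s, hs, hfill⟩ := exists_filled_ball hn hC₀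
  set w := volume.real (Metric.ball (0 : Space n) 1) with hw
  have hw0 : 0 < w := measureReal_unitBall_pos
  have hn0 : (0 : ℝ) < n := by exact_mod_cast (by omega : 0 < n)
  refine ⟨C₀ / w + n / (s / 4), s / 4, by positivity, by positivity,
    fun β K Q R hctrl hR E hE F hF hFR x₀ r hr hEF => ?_⟩
  have hβ := hctrl.one_le_beta
  have hEfin := hE.volume_ne_top
  have hFfin : volume F ≠ ∞ := ((measure_mono hFR).trans_lt measure_ball_lt_top).ne
  have hen : energy β K Q E ≤ ENNReal.ofReal C₀ :=
    (hE.energy_le_energy_ball hR).trans (hball β K Q hctrl)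
  have hdfin : volume (symmDiff E F) ≠ ∞ := ((measure_mono hEF).trans_lt measure_ball_lt_top).ne
  rw [← ENNReal.ofReal_toReal hdfin, ← ENNReal.ofReal_mul (by positivity)]
  set d := (volume (symmDiff E F)).toReal with hd
  have hd0 : 0 ≤ d := ENNReal.toReal_nonneg
  rcases le_total (volume.real E) (volume.real F) with hvol | hvol
  -- `F` is too large: shrink it.
  · rcases le_total (energy β K Q E) (energy β K Q F) with hEF' | hEF'
    · exact hEF'.trans (le_add_right le_rfl)
    have hdiff : volume.real F - w ≤ d := by
      rw [hw, ← hE.volume_real_eq, hd, symmDiff_comm]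
      exact measureReal_sub_le_symmDiff hFfin hEfin
    have hcharge : ENNReal.ofReal (Q ^ 2) * chargeEnergy β K F ≤ ENNReal.ofReal C₀ :=
      (le_add_left le_rfl).trans (hEF'.trans hen)
    rw [hE.volume_real_eq] at hvol
    refine (hE.energy_le_of_volume_ge hn hβ hF hFR hvol).trans ?_
    gcongr
    calc _ ≤ ENNReal.ofReal (d / w) * ENNReal.ofReal C₀ := by gcongr
      _ = ENNReal.ofReal (C₀ / w * d) := by
          rw [← ENNReal.ofReal_mul (by positivity)]
          congr 1
          ring
      _ ≤ _ := by
          gcongr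
          exact le_add_of_nonneg_right (by positivity)
  -- `F` is too small: fill it up, starting from a ball that it contains.
  · obtain ⟨y, hy, hy0⟩ := hfill β K Q R E hβ hR hE hen
    obtain ⟨z, hz, hz0⟩ := exists_ball_diff_null_of_symmDiff (by omega) hs hr hy0 hEF
    refine (hE.energy_le_of_volume_le hn hβ hR hF hFR hvol (by positivity : 0 < s / 4)
      (by linarith) hz0).trans ?_
    have hdiff : volume.real E - volume.real F ≤ d := measureReal_sub_le_symmDiff hEfin hFfin
    refine add_le_add le_rfl (ENNReal.ofReal_le_ofReal ?_)
    calc _ ≤ n / (s / 4) * d := by gcongr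
      _ ≤ _ := by
          gcongr
          exact le_add_of_nonneg_left (by positivity)
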